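/- Let $\phi$ be a 3-SAT formula without negated literals, with finitely many variables $X_i$ and finitely many clauses, each an (ordered) disjunction $c=X_i\vee X_j\vee X_k$ of three distinct variables. A complete graph $G$ is built from $\phi$ in which every vertex has a strict preference list of all other vertices; we give the beginning of each list, and the rest of it consists of all vertices not listed yet, in an arbitrary order. Here $D$ inside a list stands for $d_0>d_1>d_2>d_3$, and a set inside a list stands for its elements in an arbitrary order. The vertices and lists are grouped into the following gadgets. * $D$-gadget: $d_0: d_1>d_2>d_3$; $d_1: d_2>d_3>d_0$; $d_2: d_3>d_1>d_0$; $d_3: d_1>d_2>d_0$. * Level 1, one gadget for each variable $X_i$: $x_i$ and $x'_i$: $y_i>y'_i>D$; $y_i$ and $y'_i$: $x_i>x'_i>D$. * Level 0, six gadgets for each clause $c=X_i\vee X_j\vee X_k$ (superscript $c$ omitted). For $g=0,1,2$, with $a=a_{2g+1}$, $\bar a=a_{2g+2}$, $b=b_{2g+1}$, $\bar b=b_{2g+2}$: $a: b>y'_{\beta}>\bar b>D$; $\bar a:\bar b>b>D$; $b:\bar a>x'_{\gamma}>a>D$; $\bar b: a>\bar a>D$, where $(\beta,\gamma)=(j,k),(k,i),(i,j)$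 for $g=0,1,2$. Three more gadgets have vertices $a'_1,\dots,a'_6,b'_1,\dots,b'_6$ and analogous lists, with $(\beta,\gamma)=(k,j),(i,k),(j,i)$ for $g=0,1,2$. * Level 2, six gadgets for each clause. For $g=0,1,2$, with $P_r=p_{3g+r}$, $Q_r=q_{3g+r}$: $P_0: Q_0>Q_2>D$; $P_1:Q_1>Q_2>D$; $P_2:Q_0>y_\beta>Q_1>Q_2>D$; $Q_0:P_0>P_2>D$; $Q_1:P_1>P_2>D$; $Q_2:P_1>x_\gamma>P_0>P_2>D$, where $(\beta,\gamma)=(j,k),(k,i),(i,j)$ for $g=0,1,2$. Three more gadgets have primed vertices $p'_r,q'_r$ ($0\le r\le 8$) and exactly analogous lists, with the same $(\beta,\gamma)$. * Level 3, two gadgets for each clause. $s_0: t_1>q_0>t_2>q_3>t_3>D>t_0$; $t_0: s_3>p_7>s_2>p_4>s_1>D>s_0$; and for $r=1,2,3$, $s_r: t_r>t_0>D$ and $t_r:s_r>s_0>D$. The second gadget is analogous, with all of the $s,t,p,q$ primed. * $Z$-gadget: let $A=\bigcup_i\{x_i,y_i\}$, let $B$ be the set of all $p^c_{3i+1},q^c_{3i},p'^c_{3i+1},q'^c_{3i}$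 ($i=0,1,2$, all clauses $c$), and let $E$ be the set of all level 0 vertices. $z_0: z_4>z_5>A>B>E>z_1>z_2>z_3>D$; $z_1: z_5>z_4>A>B>E>z_0>z_3>z_2>D$; $z_2:z_0>z_1>z_3>z_4>z_5>D$; $z_3:z_1>z_0>z_2>z_5>z_4>D$; $z_4:z_2>z_3>z_5>z_0>z_1>D$; $z_5:z_3>z_2>z_4>z_1>z_0>D$. A vertex prefers a matching $M$ to a matching $N$ if it is matched in $M$ and either unmatched in $N$ or prefers its partner in $M$ to its partner in $N$. A matching $M$ is *popular* if for every matching $N$ at least as many vertices prefer $M$ to $N$ as prefer $N$ to $M$. A pair $\{u,v\}$ *blocks* $M$ if $u$ and $v$ prefer each other to their respective assignments in $M$ (being unmatched is the worst assignment). A gadget is in *unstable state* with respect to $M$ if some pair of its vertices blocks $M$. **Theorem.** For every choice of the arbitrary orders: 1. every popular matching of $G$ contains only edges that join two vertices of the same gadget; 2. for every popular matching $M$ of $G$ and every clause $c=X_i\vee X_j\vee X_k$, exactly one of the level 1 gadgets of $X_i,X_j,X_k$ is in unstable state with respect to $M$; 3. if $G$ has a popular matching, then $\phi$ has a 1-in-3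 satisfying assignment, i.e. a truth assignment for which every clause has exactly one true variable. -/

import Mathlib

/-! ### Popular matchings in roommates instances with complete preference lists -/

/-- Complete strict preference lists on the vertex set `W`: the list of `u` contains every vertex
other than `u` exactly once, from the most preferred to the least preferred one. -/
structure Preferences (W : Type*) where
  list : W → List W
  nodup : ∀ u, (list u).Nodup
  mem_iff : ∀ u v, v ∈ list u ↔ v ≠ u

/-- A set of edges of the complete graph on `W` (used together with `IsMatching`). -/
abbrev EdgeSet (W : Type*) := (⊤ : SimpleGraph W).Subgraph

namespace Preferences

variable {W : Type*} (P : Preferences W)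

/-- `u` prefers `v` to `w`: `v` occurs before `w` in the list of `u`. -/
def Prefers (u v w : W) : Prop := List.Sublist [v, w] (P.list u)

/-- `u` prefers the matching `M` to the matching `N`: `u` is matched in `M`, and it is unmatched
in `N` or prefers its partner in `M` to its partner in `N`. -/
def PrefersMatching (M N : EdgeSet W) (u : W) : Prop :=
  ∃ v, M.Adj u v ∧ ∀ w, N.Adj u w → P.Prefers u v w

/-- The number of vertices that prefer `M` to `N`. -/
noncomputable def votes (M N : EdgeSet W) : ℕ := {u | P.PrefersMatching M N u}.ncard

/-- `M` is a matching that loses no head-to-head election against a matching. -/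
def IsPopular (M : EdgeSet W) : Prop :=
  M.IsMatching ∧ ∀ N : EdgeSet W, N.IsMatching → P.votes N M ≤ P.votes M N

/-- `u` and `v` prefer each other to their respective assignments in `M` (being unmatched is the
worst assignment). -/
def IsBlocking (M : EdgeSet W) (u v : W) : Prop :=
  u ≠ v ∧ (∀ w, M.Adj u w → P.Prefers u v w) ∧ (∀ w, M.Adj v w → P.Prefers v u w)

end Preferences

/-! ### 1-in-3 SAT -/

/-- A 3-SAT formula without negated literals: the clause `c` is the disjunction of the three
distinct variables `var c 0`, `var c 1`, `var c 2`. -/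
structure MonotoneFormula (V C : Type*) where
  var : C → Fin 3 → V
  var_injective : ∀ c, Function.Injective (var c)

/-- In every clause exactly one variable is true. -/
def MonotoneFormula.IsOneInThree {V C : Type*} (φ : MonotoneFormula V C) (S : V → Bool) : Prop :=
  ∀ c, ∃! r : Fin 3, S (φ.var c r) = true

/-! ### The graph of a formula

The vertices that belong to a clause `c` carry a Boolean `e`: `false` for the unprimed and `true`
for the primed vertices. For the vertices of levels 0 and 2, `g : Fin 3` is the number of the gadget
among the three unprimed (or primed) gadgets of `c` and the last index is the position in the
gadget. -/

inductive GadgetVertex (V C : Type*) where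
  /-- `d_i` -/
  | d (i : Fin 4)
  /-- `z_i` -/
  | z (i : Fin 6)
  | x (i : V)
  | x' (i : V)
  | y (i : V)
  | y' (i : V)
  /-- `a_{2g+r+1}` of the clause `c`, where `r` is `0` or `1` -/
  | a (c : C) (e : Bool) (g : Fin 3) (r : Fin 2)
  /-- `b_{2g+r+1}` of the clause `c`, where `r` is `0` or `1` -/
  | b (c : C) (e : Bool) (g : Fin 3) (r : Fin 2)
  /-- `p_{3g+r}` of the clause `c`, where `r` is `0`, `1` or `2` -/
  | p (c : C) (e : Bool) (g : Fin 3) (r : Fin 3)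
  /-- `q_{3g+r}` of the clause `c`, where `r` is `0`, `1` or `2` -/
  | q (c : C) (e : Bool) (g : Fin 3) (r : Fin 3)
  | s (c : C) (e : Bool) (r : Fin 4)
  | t (c : C) (e : Bool) (r : Fin 4)
  deriving DecidableEq

inductive Gadget (V C : Type*) where
  | D
  | Z
  | level1 (i : V)
  | level0 (c : C) (e : Bool) (g : Fin 3)
  | level2 (c : C) (e : Bool) (g : Fin 3)
  | level3 (c : C) (e : Bool)
  deriving DecidableEq

namespace GadgetVertex

variable {V C : Type*}

/-- The gadget of a vertex. -/
def gadget : GadgetVertex V C → Gadget V C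
  | d _ => .D
  | z _ => .Z
  | x i => .level1 i
  | x' i => .level1 i
  | y i => .level1 i
  | y' i => .level1 i
  | a c e g _ => .level0 c e g
  | b c e g _ => .level0 c e g
  | p c e g _ => .level2 c e g
  | q c e g _ => .level2 c e g
  | s c e _ => .level3 c e
  | t c e _ => .level3 c e

/-- The block `d_0 > d_1 > d_2 > d_3`. -/
def blockD : List (GadgetVertex V C) := [d 0, d 1, d 2, d 3]

/-- The top vertices of the level 1 gadgets. -/
def topVertices : Set (GadgetVertex V C) := {v | ∃ i, v = x i ∨ v = y i}

/-- The vertices `p_{3i+1}`, `q_{3i}` of all clauses, unprimed and primed. -/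
def level2Vertices : Set (GadgetVertex V C) := {v | ∃ c e g, v = p c e g 1 ∨ v = q c e g 0}

/-- All level 0 vertices. -/
def level0Vertices : Set (GadgetVertex V C) := {v | ∃ c e g r, v = a c e g r ∨ v = b c e g r}

/-- The prescribed initial segment of the preference list of a vertex. The lists `L₁`, `L₂`, `L₀`
occur only for `z 0` and `z 1`; they stand for the elements of `topVertices`, `level2Vertices`,
`level0Vertices` in some order. Indices in `Fin 3` are added modulo 3: if the clause `c` is
`X_i ∨ X_j ∨ X_k`, then `φ.var c (0 + 1)` is `X_j`, `φ.var c (0 + 2)` is `X_k`,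
`φ.var c (1 + 2)` is `X_i`, and so on. -/
def listHead (φ : MonotoneFormula V C) (L₁ L₂ L₀ : List (GadgetVertex V C)) :
    GadgetVertex V C → List (GadgetVertex V C)
  | d i => ![[d 1, d 2, d 3], [d 2, d 3, d 0], [d 3, d 1, d 0], [d 1, d 2, d 0]] i
  | z i =>
    ![[z 4, z 5] ++ L₁ ++ L₂ ++ L₀ ++ [z 1, z 2, z 3] ++ blockD,
      [z 5, z 4] ++ L₁ ++ L₂ ++ L₀ ++ [z 0, z 3, z 2] ++ blockD,
      [z 0, z 1, z 3, z 4, z 5] ++ blockD,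
      [z 1, z 0, z 2, z 5, z 4] ++ blockD,
      [z 2, z 3, z 5, z 0, z 1] ++ blockD,
      [z 3, z 2, z 4, z 1, z 0] ++ blockD] i
  | x i => [y i, y' i] ++ blockD
  | x' i => [y i, y' i] ++ blockD
  | y i => [x i, x' i] ++ blockD
  | y' i => [x i, x' i] ++ blockD
  | a c e g r =>
    ![[b c e g 0, y' (φ.var c (g + if e then 2 else 1)), b c e g 1] ++ blockD,
      [b c e g 1, b c e g 0] ++ blockD] r
  | b c e g r =>
    ![[a c e g 1, x' (φ.var c (g + if e then 1 else 2)), a c e g 0] ++ blockD,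
      [a c e g 0, a c e g 1] ++ blockD] r
  | p c e g r =>
    ![[q c e g 0, q c e g 2] ++ blockD,
      [q c e g 1, q c e g 2] ++ blockD,
      [q c e g 0, y (φ.var c (g + 1)), q c e g 1, q c e g 2] ++ blockD] r
  | q c e g r =>
    ![[p c e g 0, p c e g 2] ++ blockD,
      [p c e g 1, p c e g 2] ++ blockD,
      [p c e g 1, x (φ.var c (g + 2)), p c e g 0, p c e g 2] ++ blockD] r
  | s c e r =>
    ![[t c e 1, q c e 0 0, t c e 2, q c e 1 0, t c e 3] ++ blockD ++ [t c e 0],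
      [t c e 1, t c e 0] ++ blockD,
      [t c e 2, t c e 0] ++ blockD,
      [t c e 3, t c e 0] ++ blockD] r
  | t c e r =>
    ![[s c e 3, p c e 2 1, s c e 2, p c e 1 1, s c e 1] ++ blockD ++ [s c e 0],
      [s c e 1, s c e 0] ++ blockD,
      [s c e 2, s c e 0] ++ blockD,
      [s c e 3, s c e 0] ++ blockD] r

end GadgetVertex

open GadgetVertex in
/-- `P` is one of the instances constructed from `φ`: every preference list begins as prescribed
and continues with all vertices not listed yet, in an arbitrary order. -/
def IsInstanceOf {V C : Type*} (φ : MonotoneFormula V C)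
    (P : Preferences (GadgetVertex V C)) : Prop :=
  ∀ u, ∃ L₁ L₂ L₀ : List (GadgetVertex V C),
    (∀ v, v ∈ L₁ ↔ v ∈ topVertices) ∧ (∀ v, v ∈ L₂ ↔ v ∈ level2Vertices) ∧
    (∀ v, v ∈ L₀ ↔ v ∈ level0Vertices) ∧ listHead φ L₁ L₂ L₀ u <+: P.list u

/-- The gadget `A` is in unstable state with respect to `M`: an edge inside `A` blocks `M`. -/
def IsUnstable {V C : Type*} (P : Preferences (GadgetVertex V C))
    (M : EdgeSet (GadgetVertex V C)) (A : Gadget V C) : Prop :=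
  ∃ u v, u.gadget = A ∧ v.gadget = A ∧ P.IsBlocking M u v

/-!
A popular matching `M` of the graph of `φ` is perfect, because the graph is complete and has an even
number of vertices. So `M` is given by a fixed-point free involution `m`, and popularity is used in
two ways.

* Local exchanges (`IsPopularInvolution.sum_gain_le`): if a list of disjoint edges replaces the
  edges of `m` that it meets, each vertex that is left alone costs one vote, so the votes gained by
  the new edges are at most the number of these vertices.
* Comparison with a reference matching (`IsPopularInvolution.collected_eq_zero`): votes may be moved
  along the edges of `m`. If afterwards no edge of the reference matching collects a negative
  amount, each of them collects exactly zero.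

The reference matching `refPartner` is stable inside all gadgets outside the `D`-gadget except on
level 3, where its blocking pair `s_ρ`, `t_ρ` depends on `m` (`IsChoice`); votes move to the core,
which consists of the `D`-gadget and the vertices `s_0`, `t_0`. Since every edge collects zero, an
edge of `m` outside the core is an edge of the reference matching, or exactly one of its ends
prefers it to the reference matching (`up_or_up`). As both stable matchings of the level 0 gadgets
may be used, only few partners remain for each vertex, and the `D`-gadget is matched inside itself.

A matching inside the `D`-gadget always has a blocking pair. An exchange that uses it joins any two
vertices that prefer the `D`-gadget to their partners by an alternating path that gains two votes
(`IsPopularIn.sum_gain_add_two_le`). This excludes the remaining edges between different gadgets: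
first on the `Z`-gadget, where moreover `z 0` and `z 1` have to be partners
(`IsPopularIn.partner_z_zero`), then on the levels 1, 2 and 3 (`IsPopularIn.gadget_partner`).

The edge between `z 0` and `z 1` connects distant exchanges, since both vertices prefer `x i`, `y i`
and all level 0 vertices to each other. If two level 1 gadgets of a clause are unstable, their
blocking pairs are connected through the level 0 gadgets and this edge, and the exchange wins
(`IsPopularIn.not_unstable_and_unstable`). On level 3 there is always a blocking pair, so from the
levels 2 and 3 of a clause two exchanges with a gain of two votes each, one among the unprimed and
one among the primed vertices, reach `x` or `y` of level 1 (`IsPopularIn.exists_hasArm`). If no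
level 1 gadget of the clause is unstable, the two exchanges can be joined, directly or through
`z 0` and `z 1`, and the combined exchange wins (`IsPopularIn.exists_unstable`). So exactly one
level 1 gadget of each clause is unstable, and the variables of the unstable gadgets form a 1-in-3
satisfying assignment.
-/

/-! ### Voting against a perfect matching -/

namespace Preferences

variable {W : Type*} {P : Preferences W}

theorem Prefers.mem_left {u v w : W} (h : P.Prefers u v w) : v ≠ u :=
  (P.mem_iff u v).1 (h.subset (by simp))

theorem Prefers.mem_right {u v w : W} (h : P.Prefers u v w) : w ≠ u :=
  (P.mem_iff u w).1 (h.subset (by simp))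

theorem Prefers.ne {u v w : W} (h : P.Prefers u v w) : v ≠ w := by
  have := h.nodup (P.nodup u)
  simpa using this

/-- If the list of `u` is `A ++ v :: B`, the vertices preferred to `v` are those of `A`. -/
theorem prefers_iff_mem_of_prefix {u v w : W} {A B : List W} (h : A ++ v :: B <+: P.list u) :
    P.Prefers u w v ↔ w ∈ A := by
  obtain ⟨R, hR⟩ := h
  have hn := P.nodup u
  have hl : P.list u = A ++ v :: (B ++ R) := by rw [← hR]; simp
  rw [hl] at hn
  unfold Prefers
  rw [hl]
  have hvA : v ∉ A := fun hv => by
    have := List.disjoint_of_nodup_append hn hv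
    simp at this
  constructor
  · intro hs
    rw [List.sublist_append_iff] at hs
    obtain ⟨l₁, l₂, he, h₁, h₂⟩ := hs
    rcases l₁ with _ | ⟨a, l₁⟩
    · simp only [List.nil_append] at he
      subst he
      rw [List.cons_sublist_cons'] at h₂
      have hn' := (List.nodup_append.1 hn).2.1
      rw [List.nodup_cons] at hn'
      rcases h₂ with h₂ | ⟨_, h₂⟩
      · exact absurd (h₂.subset (by simp)) hn'.1
      · exact absurd (h₂.subset (by simp)) hn'.1
    · simp only [List.cons_append, List.cons.injEq] at he
      rw [he.1]
      exact h₁.subset (by simp)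
  · intro hw
    have h₁ : List.Sublist [w] A := by simpa using hw
    have h₂ : List.Sublist [v] (v :: (B ++ R)) := by simp
    exact h₁.append h₂

theorem prefers_asymm {u v w : W} (h : P.Prefers u v w) : ¬ P.Prefers u w v := by
  intro h'
  obtain ⟨A, B, hl⟩ := List.append_of_mem ((P.mem_iff u w).2 h.mem_right)
  have hp : A ++ w :: B <+: P.list u := by rw [hl]
  have hA := (prefers_iff_mem_of_prefix hp).1 h
  have hn := P.nodup u
  obtain ⟨A', B', hl'⟩ := List.append_of_mem hA
  have hp' : A' ++ v :: (B' ++ w :: B) <+: P.list u := by rw [hl, hl']; simp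
  have hA' := (prefers_iff_mem_of_prefix hp').1 h'
  rw [hl, hl'] at hn
  have := List.disjoint_of_nodup_append hn (show w ∈ A' ++ v :: B' by simp [hA'])
  simp at this

theorem prefers_total {u v w : W} (hv : v ≠ u) (hw : w ≠ u) (hvw : v ≠ w) :
    P.Prefers u v w ∨ P.Prefers u w v := by
  obtain ⟨A, B, hl⟩ := List.append_of_mem ((P.mem_iff u w).2 hw)
  by_cases hA : v ∈ A
  · exact Or.inl ((prefers_iff_mem_of_prefix (B := B) (by rw [hl])).2 hA)
  · right
    have : v ∈ P.list u := (P.mem_iff u v).2 hv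
    rw [hl] at this
    have hB : v ∈ B := by simpa [hA, hvw] using this
    obtain ⟨B₁, B₂, hB'⟩ := List.append_of_mem hB
    refine (prefers_iff_mem_of_prefix (A := A ++ w :: B₁) (B := B₂) ?_).2 (by simp)
    rw [hl, hB']; simp

/-- If the list of `u` begins with `A ++ v :: B`, then `v` is preferred to everything that is
neither `v` nor in `A`. -/
theorem prefers_of_prefix {u v w : W} {A B : List W} (h : A ++ v :: B <+: P.list u)
    (hw : w ≠ u) (hv : v ≠ w) (hA : w ∉ A) : P.Prefers u v w := by
  have hvu : v ≠ u := (P.mem_iff u v).1 (h.subset (by simp))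
  rcases prefers_total (P := P) hvu hw hv with h' | h'
  · exact h'
  · exact absurd ((prefers_iff_mem_of_prefix h).1 h') hA

open Classical in
/-- The vote of `u` in the election between the partner `v` and its partner `m u` in the matching
given by the involution `m`. The value `v = u` stands for being unmatched; it yields `-1`, because
`u` does not occur in its own list. -/
noncomputable def vote (P : Preferences W) (m : W → W) (u v : W) : ℤ :=
  if v = m u then 0 else if P.Prefers u v (m u) then 1 else -1

variable {m : W → W}

theorem neg_one_le_vote (u v : W) : -1 ≤ P.vote m u v := by
  unfold vote; split_ifs <;> norm_num

theorem vote_partner (u : W) : P.vote m u (m u) = 0 := by simp [vote]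

theorem vote_eq_one {u v : W} (h : P.Prefers u v (m u)) : P.vote m u v = 1 := by
  simp [vote, h, h.ne]

theorem vote_eq_neg_one {u v : W} (h : v ≠ m u) (h' : ¬ P.Prefers u v (m u)) :
    P.vote m u v = -1 := by
  simp [vote, h, h']

theorem vote_self {u : W} (h : m u ≠ u) : P.vote m u u = -1 :=
  vote_eq_neg_one h.symm fun h' => h'.mem_left rfl

/-- The number of votes that an additional edge `{u, v}` gains against `m`. -/
noncomputable def gain (P : Preferences W) (m : W → W) (p : W × W) : ℤ :=
  P.vote m p.1 p.2 + P.vote m p.2 p.1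

theorem gain_nonneg_left {u v : W} (h : P.Prefers u v (m u)) : 0 ≤ P.gain m (u, v) := by
  have := vote_eq_one h
  have := neg_one_le_vote (P := P) (m := m) v u
  simp only [gain]; lia

theorem gain_nonneg_right {u v : W} (h : P.Prefers v u (m v)) : 0 ≤ P.gain m (u, v) := by
  have := vote_eq_one h
  have := neg_one_le_vote (P := P) (m := m) u v
  simp only [gain]; lia

theorem two_le_gain {u v : W} (h : P.Prefers u v (m u)) (h' : P.Prefers v u (m v)) :
    2 ≤ P.gain m (u, v) := by
  have := vote_eq_one h
  have := vote_eq_one h'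
  simp only [gain]; lia

/-- The matching given by the involution `m` is perfect, and it loses no election against a
matching; an involution `n` stands for the matching that leaves the fixed points of `n`
unmatched. -/
structure IsPopularInvolution [Fintype W] (P : Preferences W) (m : W → W) : Prop where
  invol : ∀ u, m (m u) = u
  ne : ∀ u, m u ≠ u
  sum_vote_nonpos : ∀ n : W → W, (∀ u, n (n u) = u) → ∑ u, P.vote m u (n u) ≤ 0

/-- The matching of an involution; fixed points are unmatched. -/
def matchingOf (n : W → W) (hn : ∀ u, n (n u) = u) : EdgeSet W where
  verts := {u | n u ≠ u}
  Adj u v := n u = v ∧ u ≠ v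
  adj_sub h := by simpa using h.2
  edge_vert {u v} h := by
    change n u ≠ u
    rw [h.1]; exact h.2.symm
  symm := ⟨fun u v h => ⟨by rw [← h.1, hn], h.2.symm⟩⟩

theorem matchingOf_isMatching (n : W → W) (hn : ∀ u, n (n u) = u) :
    (matchingOf n hn).IsMatching := by
  intro u hu
  exact ⟨n u, ⟨rfl, Ne.symm hu⟩, fun v hv => hv.1.symm⟩

/-- On a set of even size a popular matching is perfect, and so it is given by a popular
involution. -/
theorem IsPopular.exists_involution [Fintype W] {M : EdgeSet W} (hM : P.IsPopular M)
    (heven : Even (Fintype.card W)) :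
    ∃ m, P.IsPopularInvolution m ∧ ∀ u v, M.Adj u v ↔ m u = v := by
  classical
  obtain ⟨hmat, hpop⟩ := hM
  have hperf : ∀ u, ∃ v, M.Adj u v := by
    by_contra! hu
    obtain ⟨u, hu⟩ := hu
    -- By parity there is a second unmatched vertex `w`, and adding the edge `{u, w}` gains votes.
    have huM : u ∉ M.verts := fun h => by
      obtain ⟨v, hv, _⟩ := hmat h
      exact hu v hv
    have hcard : Even (M.verts.toFinsetᶜ.card) := by
      rw [Finset.card_compl, Nat.even_sub (Finset.card_le_univ _)]
      simp only [heven, true_iff]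
      convert hmat.even_card
    have hpos : 1 < M.verts.toFinsetᶜ.card := by
      have h1 : 0 < M.verts.toFinsetᶜ.card := Finset.card_pos.2 ⟨u, by simp [huM]⟩
      obtain ⟨k, hk⟩ := hcard
      omega
    obtain ⟨w, hw, hwu⟩ := Finset.exists_mem_ne hpos u
    have hwM : w ∉ M.verts := by simpa using hw
    have hdis : Disjoint M.support
        ((⊤ : SimpleGraph W).subgraphOfAdj
          (by simpa using hwu.symm : (⊤ : SimpleGraph W).Adj u w)).support := by
      rw [hmat.support_eq_verts, (SimpleGraph.Subgraph.IsMatching.subgraphOfAdj _).support_eq_verts]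
      rw [Set.disjoint_left]
      rintro a ha (rfl | rfl)
      · exact huM ha
      · exact hwM ha
    have hN := hmat.sup (SimpleGraph.Subgraph.IsMatching.subgraphOfAdj _) hdis
    have h := hpop _ hN
    have h0 : P.votes M (M ⊔ (⊤ : SimpleGraph W).subgraphOfAdj
        (by simpa using hwu.symm : (⊤ : SimpleGraph W).Adj u w)) = 0 := by
      unfold votes
      rw [Set.ncard_eq_zero (Set.toFinite _), Set.eq_empty_iff_forall_notMem]
      rintro a ⟨v, hv, hv'⟩
      exact (hv' v (by simp [hv])).ne rfl
    have h1 : 0 < P.votes (M ⊔ (⊤ : SimpleGraph W).subgraphOfAdj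
        (by simpa using hwu.symm : (⊤ : SimpleGraph W).Adj u w)) M := by
      unfold votes
      rw [Set.ncard_pos (Set.toFinite _)]
      exact ⟨u, w, by simp, fun v hv => absurd hv (hu v)⟩
    omega
  choose m hm using hperf
  have hiff : ∀ u v, M.Adj u v ↔ m u = v := fun u v =>
    ⟨fun h => hmat.eq_of_adj_left (hm u) h, fun h => h ▸ hm u⟩
  have hinv : ∀ u, m (m u) = u := fun u => (hiff _ _).1 (hm u).symm
  have hne : ∀ u, m u ≠ u := fun u => (hm u).ne.symm
  refine ⟨m, ⟨hinv, hne, fun n hn => ?_⟩, hiff⟩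
  have h := hpop _ (matchingOf_isMatching n hn)
  have h1 : {u | P.PrefersMatching (matchingOf n hn) M u} =
      ({u | P.vote m u (n u) = 1} : Set W) := by
    ext u
    simp only [PrefersMatching, Set.mem_ofPred_eq]
    constructor
    · rintro ⟨v, ⟨rfl, _⟩, hv⟩
      exact vote_eq_one (hv _ (hm u))
    · intro hu
      have hp : P.Prefers u (n u) (m u) := by
        unfold vote at hu
        split_ifs at hu <;> first | assumption | norm_num at hu
      exact ⟨n u, ⟨rfl, hp.mem_left.symm⟩, fun w hw => by rw [← (hiff _ _).1 hw]; exact hp⟩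
  have h2 : {u | P.PrefersMatching M (matchingOf n hn) u} =
      ({u | P.vote m u (n u) = -1} : Set W) := by
    ext u
    simp only [PrefersMatching, Set.mem_ofPred_eq]
    constructor
    · rintro ⟨v, hv, hv'⟩
      obtain rfl := (hiff _ _).1 hv
      by_cases hnu : n u = u
      · rw [hnu]; exact vote_self (hne u)
      · have hp := hv' _ ⟨rfl, Ne.symm hnu⟩
        exact vote_eq_neg_one hp.ne.symm (prefers_asymm hp)
    · intro hu
      have hnm : n u ≠ m u := by
        intro h'
        simp [vote, h'] at hu
      have hp : ¬ P.Prefers u (n u) (m u) := by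
        intro h'
        rw [vote_eq_one h'] at hu
        norm_num at hu
      refine ⟨m u, hm u, ?_⟩
      rintro w ⟨rfl, hw⟩
      exact (prefers_total (P := P) hw.symm (hne u) hnm).resolve_left hp
  unfold votes at h
  rw [h1, h2] at h
  have key : ∀ u, P.vote m u (n u) = (if P.vote m u (n u) = 1 then 1 else 0)
      - (if P.vote m u (n u) = -1 then 1 else 0) := by
    intro u
    have : P.vote m u (n u) = 0 ∨ P.vote m u (n u) = 1 ∨ P.vote m u (n u) = -1 := by
      unfold vote; split_ifs <;> simp
    rcases this with h | h | h <;> simp [h]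
  rw [Finset.sum_congr rfl fun u _ => key u, Finset.sum_sub_distrib]
  simp only [Finset.sum_boole]
  rw [Set.ncard_eq_toFinset_card', Set.ncard_eq_toFinset_card'] at h
  simp only [Set.toFinset_ofPred] at h
  have : ((Finset.univ.filter fun u => P.vote m u (n u) = 1).card : ℤ) ≤
    ((Finset.univ.filter fun u => P.vote m u (n u) = -1).card : ℤ) := by exact_mod_cast h
  simpa using this

/-- The end vertices of the edges of a list. -/
def ends (E : List (W × W)) : List W := E.flatMap fun p => [p.1, p.2]

@[simp] theorem ends_nil : ends ([] : List (W × W)) = [] := rfl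

@[simp] theorem ends_cons (p : W × W) (E : List (W × W)) :
    ends (p :: E) = p.1 :: p.2 :: ends E := rfl

@[simp] theorem ends_append (E E' : List (W × W)) : ends (E ++ E') = ends E ++ ends E' := by
  simp [ends]

open Classical in
/-- The partner of a vertex in a list of disjoint edges; vertices outside are fixed. -/
noncomputable def listPartner : List (W × W) → W → W
  | [], u => u
  | p :: E, u => if u = p.1 then p.2 else if u = p.2 then p.1 else listPartner E u

theorem listPartner_mem {E : List (W × W)} {u : W} (hu : u ∈ ends E) :
    listPartner E u ∈ ends E := by
  induction E with
  | nil => simp at hu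
  | cons p E ih =>
    simp only [ends_cons, List.mem_cons] at hu ⊢
    unfold listPartner
    split_ifs <;> grind

theorem listPartner_listPartner {E : List (W × W)} (hE : (ends E).Nodup) {u : W}
    (hu : u ∈ ends E) : listPartner E (listPartner E u) = u := by
  induction E with
  | nil => simp at hu
  | cons p E ih =>
    simp only [ends_cons, List.nodup_cons, List.mem_cons, not_or] at hu hE
    by_cases h1 : u = p.1
    · have : listPartner (p :: E) u = p.2 := by simp [listPartner, h1]
      rw [this]
      have : p.2 ≠ p.1 := Ne.symm hE.1.1
      simp [listPartner, this, h1]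
    · by_cases h2 : u = p.2
      · have : listPartner (p :: E) u = p.1 := by
          simp [listPartner, h2, Ne.symm hE.1.1]
        rw [this]
        simp [listPartner, h2]
      · have hu' : u ∈ ends E := by tauto
        have h : listPartner (p :: E) u = listPartner E u := by simp [listPartner, h1, h2]
        have hm := listPartner_mem hu'
        have h3 : listPartner E u ≠ p.1 := fun h => hE.1.2 (h ▸ hm)
        have h4 : listPartner E u ≠ p.2 := fun h => hE.2.1 (h ▸ hm)
        rw [h]
        simp only [listPartner, h3, h4, if_false]
        exact ih hE.2.2 hu'

theorem sum_vote_ends {E : List (W × W)} (hE : (ends E).Nodup) :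
    ((ends E).map fun u => P.vote m u (listPartner E u)).sum = (E.map (P.gain m)).sum := by
  induction E with
  | nil => simp
  | cons p E ih =>
    simp only [ends_cons, List.nodup_cons, List.mem_cons, not_or] at hE
    have h1 : listPartner (p :: E) p.1 = p.2 := by simp [listPartner]
    have h2 : listPartner (p :: E) p.2 = p.1 := by simp [listPartner, Ne.symm hE.1.1]
    have h3 : (ends E).map (fun u => P.vote m u (listPartner (p :: E) u)) =
        (ends E).map (fun u => P.vote m u (listPartner E u)) := by
      refine List.map_congr_left fun u hu => ?_
      have h3 : u ≠ p.1 := fun h => hE.1.2 (h ▸ hu)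
      have h4 : u ≠ p.2 := fun h => hE.2.1 (h ▸ hu)
      simp [listPartner, h3, h4]
    simp only [ends_cons, List.map_cons, List.sum_cons, h1, h2, h3, ih hE.2.2, gain]
    ring

/-- The exchange argument: if disjoint edges `E` replace the edges of a popular matching that they
meet, every vertex that thereby becomes unmatched costs one vote, and these losses make up for the
gain of `E`. The list `F` contains the vertices that become unmatched. -/
theorem IsPopularInvolution.sum_gain_le [Fintype W] (hm : P.IsPopularInvolution m)
    (E : List (W × W)) (F : List W) (hE : (ends E).Nodup)
    (hF : ∀ u ∈ ends E, m u ∈ ends E ∨ m u ∈ F) : (E.map (P.gain m)).sum ≤ F.length := by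
  classical
  set n : W → W := fun u =>
    if u ∈ ends E then listPartner E u else if m u ∈ ends E then u else m u with hn
  have hn_in : ∀ u ∈ ends E, n u = listPartner E u := fun u hu => by simp [hn, hu]
  have hinv : ∀ u, n (n u) = u := by
    intro u
    by_cases hu : u ∈ ends E
    · rw [hn_in u hu, hn_in _ (listPartner_mem hu), listPartner_listPartner hE hu]
    · by_cases hu' : m u ∈ ends E
      · have : n u = u := by simp [hn, hu, hu']
        rw [this, this]
      · have : n u = m u := by simp [hn, hu, hu']
        rw [this]
        simp [hn, hu', hm.invol, hu]
  have h := hm.sum_vote_nonpos n hinv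
  have hsplit : ∀ u, P.vote m u (n u) = (if u ∈ (ends E).toFinset then P.vote m u (listPartner E u)
      else 0) - (if u ∉ ends E ∧ m u ∈ ends E then 1 else 0) := by
    intro u
    by_cases hu : u ∈ ends E
    · simp [hn_in u hu, hu]
    · by_cases hu' : m u ∈ ends E
      · have : n u = u := by simp [hn, hu, hu']
        rw [this, vote_self (hm.ne u)]
        simp [hu, hu']
      · have : n u = m u := by simp [hn, hu, hu']
        rw [this, vote_partner]
        simp [hu, hu']
  rw [Finset.sum_congr rfl fun u _ => hsplit u, Finset.sum_sub_distrib] at h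
  rw [Finset.sum_ite_mem, Finset.univ_inter, Finset.sum_boole, List.sum_toFinset _ hE,
    sum_vote_ends hE] at h
  have hcard : (Finset.univ.filter fun u => u ∉ ends E ∧ m u ∈ ends E).card ≤ F.length := by
    refine le_trans (Finset.card_le_card (t := F.toFinset) ?_) (List.toFinset_card_le F)
    intro u hu
    simp only [Finset.mem_filter, Finset.mem_univ, true_and] at hu
    have := hF _ hu.2
    rw [hm.invol] at this
    simpa [hu.1] using this
  have : ((Finset.univ.filter fun u => u ∉ ends E ∧ m u ∈ ends E).card : ℤ) ≤ F.length := by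
    exact_mod_cast hcard
  linarith

/-- The comparison of a popular matching `m` with a matching `n`, where votes are moved along the
edges of `m` by an antisymmetric transfer `T` and then collected along the edges of `n`. If no edge
of `n` collects a negative amount, every edge of `n` collects exactly `0`. -/
theorem IsPopularInvolution.collected_eq_zero [Fintype W] (hm : P.IsPopularInvolution m)
    (n : W → W) (hn : ∀ u, n (n u) = u) (T h : W → ℤ) (hT : ∀ u, T (m u) = - T u)
    (hh : ∀ u, h u = P.vote m u (n u) + P.vote m (m u) (n (m u)) + T u)
    (hpos : ∀ u, 0 ≤ h u + h (n u)) (u : W) : h u + h (n u) = 0 := by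
  have reindex : ∀ (k : W → W), (∀ u, k (k u) = u) → ∀ f : W → ℤ, ∑ u, f (k u) = ∑ u, f u :=
    fun k hk f => Equiv.sum_comp ⟨k, k, hk, hk⟩ f
  have hs := hm.sum_vote_nonpos n hn
  have hT0 : ∑ u, T u = 0 := by
    have := reindex m hm.invol T
    simp only [hT, Finset.sum_neg_distrib] at this
    linarith
  have h1 : ∑ u, h u ≤ 0 := by
    simp only [hh, Finset.sum_add_distrib, hT0,
      reindex m hm.invol fun u => P.vote m u (n u)]
    linarith
  have h2 : ∑ u, (h u + h (n u)) ≤ 0 := by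
    rw [Finset.sum_add_distrib, reindex n hn h]
    linarith
  have h3 := (Finset.sum_eq_zero_iff_of_nonneg fun u _ => hpos u).1
    (le_antisymm h2 (Finset.sum_nonneg fun u _ => hpos u))
  exact h3 u (Finset.mem_univ u)

end Preferences

section

open GadgetVertex Preferences

variable {V C : Type*}

/-! ### Initial segments of the preference lists -/

section Lists

variable {φ : MonotoneFormula V C} {P : Preferences (GadgetVertex V C)}

theorem IsInstanceOf.isPrefix (hP : IsInstanceOf φ P) {u v : GadgetVertex V C}
    {A B : List (GadgetVertex V C)} (h : ∀ L₁ L₂ L₀, listHead φ L₁ L₂ L₀ u = A ++ v :: B) :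
    A ++ v :: B <+: P.list u := by
  obtain ⟨L₁, L₂, L₀, -, -, -, hp⟩ := hP u
  rwa [h] at hp

theorem IsInstanceOf.prefers_iff (hP : IsInstanceOf φ P) {u v w : GadgetVertex V C}
    (A : List (GadgetVertex V C)) {B : List (GadgetVertex V C)}
    (h : ∀ L₁ L₂ L₀, listHead φ L₁ L₂ L₀ u = A ++ v :: B) : P.Prefers u w v ↔ w ∈ A :=
  prefers_iff_mem_of_prefix (hP.isPrefix h)

theorem IsInstanceOf.prefers (hP : IsInstanceOf φ P) {u v w : GadgetVertex V C}
    (A : List (GadgetVertex V C)) {B : List (GadgetVertex V C)}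
    (h : ∀ L₁ L₂ L₀, listHead φ L₁ L₂ L₀ u = A ++ v :: B)
    (hw : w ∉ u :: v :: A) : P.Prefers u v w := by
  simp only [List.mem_cons, not_or] at hw
  exact prefers_of_prefix (hP.isPrefix h) hw.1 (Ne.symm hw.2.1) hw.2.2

theorem IsInstanceOf.prefers_first (hP : IsInstanceOf φ P) {u v w : GadgetVertex V C}
    (h : ∀ L₁ L₂ L₀, (listHead φ L₁ L₂ L₀ u).head? = some v) (hw : w ≠ u) (hv : v ≠ w) :
    P.Prefers u v w := by
  obtain ⟨L₁, L₂, L₀, -, -, -, hp⟩ := hP u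
  obtain ⟨B, hB⟩ := List.head?_eq_some_iff.1 (h L₁ L₂ L₀)
  rw [hB] at hp
  exact prefers_of_prefix (A := []) hp hw hv (by simp)

/-- A vertex prefers the vertices of the `D`-gadget to everything listed behind them. -/
theorem IsInstanceOf.prefers_d (hP : IsInstanceOf φ P) {u w : GadgetVertex V C}
    (A : List (GadgetVertex V C)) {B : List (GadgetVertex V C)}
    (h : ∀ L₁ L₂ L₀, listHead φ L₁ L₂ L₀ u = A ++ (blockD ++ B))
    (hw : w ∉ u :: A) (hd : ∀ i, w ≠ d i) (j : Fin 4) : P.Prefers u (d j) w := by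
  simp only [List.mem_cons, not_or] at hw
  have hd0 := hd 0
  have hd1 := hd 1
  have hd2 := hd 2
  have hd3 := hd 3
  fin_cases j
  · exact hP.prefers (v := d 0) A (fun L₁ L₂ L₀ => by rw [h]; rfl) (by simp [hw, hd0])
  · exact hP.prefers (v := d 1) (A ++ [d 0]) (fun L₁ L₂ L₀ => by rw [h]; simp [blockD]; rfl)
      (by simp [hw, hd0, hd1])
  · exact hP.prefers (v := d 2) (A ++ [d 0, d 1])
      (fun L₁ L₂ L₀ => by rw [h]; simp [blockD]; rfl) (by simp [hw, hd0, hd1, hd2])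
  · exact hP.prefers (v := d 3) (A ++ [d 0, d 1, d 2])
      (fun L₁ L₂ L₀ => by rw [h]; simp [blockD]; rfl) (by simp [hw, hd0, hd1, hd2, hd3])

/-- Inside the `D`-gadget all vertices prefer each other to the rest of the graph. -/
theorem IsInstanceOf.d_prefers (hP : IsInstanceOf φ P) {i j : Fin 4} (hij : j ≠ i)
    {w : GadgetVertex V C} (hd : ∀ i, w ≠ d i) : P.Prefers (d i) (d j) w := by
  have hd0 := hd 0
  have hd1 := hd 1
  have hd2 := hd 2
  have hd3 := hd 3
  fin_cases i <;> fin_cases j <;> first | exact absurd rfl hij | skip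
  all_goals first
    | exact hP.prefers [] (fun L₁ L₂ L₀ => rfl) (by simp [hd0, hd1, hd2, hd3])
    | exact hP.prefers [_] (fun L₁ L₂ L₀ => rfl) (by simp [hd0, hd1, hd2, hd3])
    | exact hP.prefers [_, _] (fun L₁ L₂ L₀ => rfl) (by simp [hd0, hd1, hd2, hd3])

/-- The vertices that `z 0` prefers to `z 1`, and `z 1` to `z 0`. -/
def AboveZ (w : GadgetVertex V C) : Prop :=
  w = z 4 ∨ w = z 5 ∨ w ∈ topVertices ∨ w ∈ level2Vertices ∨ w ∈ level0Vertices

theorem IsInstanceOf.prefers_z_zero_iff (hP : IsInstanceOf φ P) {w : GadgetVertex V C} :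
    P.Prefers (z 0) w (z 1) ↔ AboveZ w := by
  obtain ⟨L₁, L₂, L₀, h₁, h₂, h₀, hp⟩ := hP (z 0)
  have : ([z 4, z 5] ++ L₁ ++ L₂ ++ L₀) ++ z 1 :: ([z 2, z 3] ++ blockD) <+: P.list (z 0) := by
    simpa [listHead] using hp
  rw [prefers_iff_mem_of_prefix this]
  simp [AboveZ, h₁, h₂, h₀]

theorem IsInstanceOf.prefers_z_one_iff (hP : IsInstanceOf φ P) {w : GadgetVertex V C} :
    P.Prefers (z 1) w (z 0) ↔ AboveZ w := by
  obtain ⟨L₁, L₂, L₀, h₁, h₂, h₀, hp⟩ := hP (z 1)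
  have : ([z 5, z 4] ++ L₁ ++ L₂ ++ L₀) ++ z 0 :: ([z 3, z 2] ++ blockD) <+: P.list (z 1) := by
    simpa [listHead] using hp
  rw [prefers_iff_mem_of_prefix this]
  simp only [AboveZ, List.mem_append, List.mem_cons, h₁, h₂, h₀, List.not_mem_nil]
  tauto

/-- The order in which a vertex of the `Z`-gadget ranks the other ones. -/
def orderZ (i : Fin 6) : List (Fin 6) :=
  ![[4, 5, 1, 2, 3], [5, 4, 0, 3, 2], [0, 1, 3, 4, 5], [1, 0, 2, 5, 4], [2, 3, 5, 0, 1],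
    [3, 2, 4, 1, 0]] i

theorem IsInstanceOf.prefers_z (hP : IsInstanceOf φ P) {i j k : Fin 6}
    (h : List.Sublist [j, k] (orderZ i)) : P.Prefers (z i) (z j) (z k) := by
  obtain ⟨L₁, L₂, L₀, -, -, -, hp⟩ := hP (z i)
  have hl : List.Sublist ((orderZ i).map z) (listHead φ L₁ L₂ L₀ (z i)) := by
    fin_cases i
    · have : listHead φ L₁ L₂ L₀ (z 0) =
          [z 4, z 5] ++ ((L₁ ++ L₂ ++ L₀) ++ ([z 1, z 2, z 3] ++ blockD)) := by simp [listHead]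
      change List.Sublist ([z 4, z 5] ++ [z 1, z 2, z 3]) (listHead φ L₁ L₂ L₀ (z 0))
      rw [this]
      exact (List.Sublist.refl _).append
        ((List.sublist_append_left _ _).trans (List.sublist_append_right _ _))
    · have : listHead φ L₁ L₂ L₀ (z 1) =
          [z 5, z 4] ++ ((L₁ ++ L₂ ++ L₀) ++ ([z 0, z 3, z 2] ++ blockD)) := by simp [listHead]
      change List.Sublist ([z 5, z 4] ++ [z 0, z 3, z 2]) (listHead φ L₁ L₂ L₀ (z 1))
      rw [this]
      exact (List.Sublist.refl _).append
        ((List.sublist_append_left _ _).trans (List.sublist_append_right _ _))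
    all_goals exact List.sublist_append_left _ blockD
  exact ((h.map z).trans hl).trans hp.sublist

end Lists

/-! ### The reference matching -/

section Reference

/-- The reference matching, to which popular matchings are compared. It is stable on the level 1,
level 2 and `Z`-gadgets. On level 0 the flag `τ` chooses one of the two stable matchings of the
gadgets, on level 3 the vertices of index `0` are joined to those of index `ρ`, and on the
`D`-gadget the matching is given by `ν`. -/
def refPartner (τ : Bool) (ρ : C → Bool → Fin 4) (ν : Fin 4 → Fin 4) :
    GadgetVertex V C → GadgetVertex V C
  | d i => d (ν i)
  | z i => z (![1, 0, 3, 2, 5, 4] i)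
  | x i => y i
  | x' i => y' i
  | y i => x i
  | y' i => x' i
  | a c e g r => b c e g (if τ then r + 1 else r)
  | b c e g r => a c e g (if τ then r + 1 else r)
  | p c e g r => q c e g r
  | q c e g r => p c e g r
  | s c e r => t c e (Equiv.swap 0 (ρ c e) r)
  | t c e r => s c e (Equiv.swap 0 (ρ c e) r)

theorem refPartner_refPartner (τ : Bool) (ρ : C → Bool → Fin 4) {ν : Fin 4 → Fin 4}
    (hν : ∀ i, ν (ν i) = i) (u : GadgetVertex V C) :
    refPartner τ ρ ν (refPartner τ ρ ν u) = u := by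
  cases u with
  | z i => fin_cases i <;> rfl
  | a c e g r => cases τ <;> fin_cases r <;> rfl
  | b c e g r => cases τ <;> fin_cases r <;> rfl
  | d i => simp [refPartner, hν]
  | s c e r => simp [refPartner]
  | t c e r => simp [refPartner]
  | _ => rfl

/-- The vertices outside the `D`-gadget that `u` prefers to its partner in the reference matching
(for `u` outside the `D`-gadget). -/
def Up (φ : MonotoneFormula V C) (τ : Bool) (ρ : C → Bool → Fin 4) :
    GadgetVertex V C → GadgetVertex V C → Prop
  | d _, _ => False
  | z i, w => (i = 0 ∨ i = 1) ∧ AboveZ w ∨ (i = 2 ∨ i = 3) ∧ (w = z 0 ∨ w = z 1) ∨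
      (i = 4 ∨ i = 5) ∧ (w = z 2 ∨ w = z 3)
  | x _, _ => False
  | x' i, w => w = y i
  | y _, _ => False
  | y' i, w => w = x i
  | a c e g r, w => τ = true ∧
      (r = 0 ∧ (w = b c e g 0 ∨ w = y' (φ.var c (g + if e then 2 else 1))) ∨
        r = 1 ∧ w = b c e g 1)
  | b c e g r, w => τ = false ∧
      (r = 0 ∧ (w = a c e g 1 ∨ w = x' (φ.var c (g + if e then 1 else 2))) ∨
        r = 1 ∧ w = a c e g 0)
  | p c e g r, w => r = 2 ∧ (w = q c e g 0 ∨ w = y (φ.var c (g + 1)) ∨ w = q c e g 1)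
  | q c e g r, w => r = 2 ∧ (w = p c e g 1 ∨ w = x (φ.var c (g + 2)) ∨ w = p c e g 0)
  | s c e r, w => r = 0 ∧ (1 < ρ c e ∧ (w = t c e 1 ∨ w = q c e 0 0) ∨
        2 < ρ c e ∧ (w = t c e 2 ∨ w = q c e 1 0)) ∨
      r = ρ c e ∧ w = t c e (ρ c e)
  | t c e r, w => r = 0 ∧ (ρ c e < 3 ∧ (w = s c e 3 ∨ w = p c e 2 1) ∨
        ρ c e < 2 ∧ (w = s c e 2 ∨ w = p c e 1 1)) ∨
      r = ρ c e ∧ w = s c e (ρ c e)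

variable {φ : MonotoneFormula V C} {P : Preferences (GadgetVertex V C)}
  {τ : Bool} {ρ : C → Bool → Fin 4} {ν : Fin 4 → Fin 4}

theorem fin_four_cases {r : Fin 4} (h : r ≠ 0) : r = 1 ∨ r = 2 ∨ r = 3 := by
  fin_cases r <;> simp_all

theorem IsInstanceOf.prefers_refPartner_iff (hP : IsInstanceOf φ P) (hρ : ∀ c e, ρ c e ≠ 0)
    {u w : GadgetVertex V C} (hu : ∀ i, u ≠ d i) :
    P.Prefers u w (refPartner τ ρ ν u) ↔ Up φ τ ρ u w := by
  cases u with
  | d i => exact absurd rfl (hu i)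
  | z i =>
    fin_cases i
    · exact hP.prefers_z_zero_iff.trans (by simp [Up])
    · exact hP.prefers_z_one_iff.trans (by simp [Up])
    · exact (hP.prefers_iff (v := z 3) [z 0, z 1] fun _ _ _ => rfl).trans (by simp [Up])
    · exact (hP.prefers_iff (v := z 2) [z 1, z 0] fun _ _ _ => rfl).trans
        (by simp [Up, or_comm])
    · exact (hP.prefers_iff (v := z 5) [z 2, z 3] fun _ _ _ => rfl).trans (by simp [Up])
    · exact (hP.prefers_iff (v := z 4) [z 3, z 2] fun _ _ _ => rfl).trans
        (by simp [Up, or_comm])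
  | x i => exact (hP.prefers_iff [] fun _ _ _ => rfl).trans (by simp [Up])
  | x' i => exact (hP.prefers_iff [_] fun _ _ _ => rfl).trans (by simp [Up])
  | y i => exact (hP.prefers_iff [] fun _ _ _ => rfl).trans (by simp [Up])
  | y' i => exact (hP.prefers_iff [_] fun _ _ _ => rfl).trans (by simp [Up])
  | a c e g r =>
    cases τ <;> fin_cases r
    · exact (hP.prefers_iff [] fun _ _ _ => rfl).trans (by simp [Up])
    · exact (hP.prefers_iff [] fun _ _ _ => rfl).trans (by simp [Up])
    · exact (hP.prefers_iff (v := b c e g 1) [_, _] fun _ _ _ => rfl).trans (by simp [Up])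
    · exact (hP.prefers_iff (v := b c e g 0) [_] fun _ _ _ => rfl).trans (by simp [Up])
  | b c e g r =>
    cases τ <;> fin_cases r
    · exact (hP.prefers_iff [_, _] fun _ _ _ => rfl).trans (by simp [Up])
    · exact (hP.prefers_iff [_] fun _ _ _ => rfl).trans (by simp [Up])
    · exact (hP.prefers_iff (v := a c e g 1) [] fun _ _ _ => rfl).trans (by simp [Up])
    · exact (hP.prefers_iff (v := a c e g 0) [] fun _ _ _ => rfl).trans (by simp [Up])
  | p c e g r =>
    fin_cases r
    · exact (hP.prefers_iff [] fun _ _ _ => rfl).trans (by simp [Up])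
    · exact (hP.prefers_iff [] fun _ _ _ => rfl).trans (by simp [Up])
    · exact (hP.prefers_iff [_, _, _] fun _ _ _ => rfl).trans (by simp [Up])
  | q c e g r =>
    fin_cases r
    · exact (hP.prefers_iff [] fun _ _ _ => rfl).trans (by simp [Up])
    · exact (hP.prefers_iff [] fun _ _ _ => rfl).trans (by simp [Up])
    · exact (hP.prefers_iff [_, _, _] fun _ _ _ => rfl).trans (by simp [Up])
  | s c e r =>
    rcases fin_four_cases (hρ c e) with h | h | h <;> fin_cases r <;>
      simp only [refPartner, Up, h, Equiv.swap_apply_def] <;>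
      first
      | exact (hP.prefers_iff [] fun _ _ _ => rfl).trans (by simp)
      | exact (hP.prefers_iff [_] fun _ _ _ => rfl).trans (by simp)
      | exact (hP.prefers_iff [_, _] fun _ _ _ => rfl).trans (by simp)
      | exact (hP.prefers_iff [_, _, _, _] fun _ _ _ => rfl).trans (by simp; tauto)
  | t c e r =>
    rcases fin_four_cases (hρ c e) with h | h | h <;> fin_cases r <;>
      simp only [refPartner, Up, h, Equiv.swap_apply_def] <;>
      first
      | exact (hP.prefers_iff [] fun _ _ _ => rfl).trans (by simp)
      | exact (hP.prefers_iff [_] fun _ _ _ => rfl).trans (by simp)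
      | exact (hP.prefers_iff [_, _] fun _ _ _ => rfl).trans (by simp)
      | exact (hP.prefers_iff [_, _, _, _] fun _ _ _ => rfl).trans (by simp; tauto)

/-- Outside the `D`-gadget, the reference matching is blocked only by the pairs `s_ρ`, `t_ρ`. -/
theorem Up.eq_of_symm {u w : GadgetVertex V C} (h : Up φ τ ρ u w) (h' : Up φ τ ρ w u)
    (hρ : ∀ c e, ρ c e ≠ 0) :
    ∃ c e, u = s c e (ρ c e) ∧ w = t c e (ρ c e) ∨ u = t c e (ρ c e) ∧ w = s c e (ρ c e) := by
  rcases u with i | i | i | i | i | i | ⟨c, e, g, r⟩ | ⟨c, e, g, r⟩ | ⟨c, e, g, r⟩ |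
      ⟨c, e, g, r⟩ | ⟨c, e, r⟩ | ⟨c, e, r⟩ <;>
    rcases w with j | j | j | j | j | j | ⟨c', e', g', r'⟩ | ⟨c', e', g', r'⟩ | ⟨c', e', g', r'⟩ |
      ⟨c', e', g', r'⟩ | ⟨c', e', r'⟩ | ⟨c', e', r'⟩ <;>
    simp only [Up, AboveZ, topVertices, level2Vertices, level0Vertices, Set.mem_ofPred_eq,
      reduceCtorEq, and_false, exists_false, or_false, false_or,
      GadgetVertex.z.injEq, GadgetVertex.a.injEq, GadgetVertex.b.injEq,
      GadgetVertex.p.injEq, GadgetVertex.q.injEq, GadgetVertex.s.injEq,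
      GadgetVertex.t.injEq] at h h' ⊢
  · lia
  · grind
  · grind
  · grind
  · grind
  · have := hρ c e
    obtain ⟨rfl, rfl⟩ : c' = c ∧ e' = e := by tauto
    exact ⟨c', e', by grind⟩
  · have := hρ c e
    obtain ⟨rfl, rfl⟩ : c' = c ∧ e' = e := by tauto
    exact ⟨c', e', by grind⟩

/-- The vertices that the others rank behind their partners in the reference matching: the
`D`-gadget and the vertices `s_0`, `t_0` of the level 3 gadgets. -/
def IsCore : GadgetVertex V C → Prop
  | d _ => True
  | s _ _ r => r = 0
  | t _ _ r => r = 0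
  | _ => False

theorem not_up_of_isCore {u w : GadgetVertex V C} (hw : IsCore w) (hρ : ∀ c e, ρ c e ≠ 0) :
    ¬ Up φ τ ρ u w := by
  intro h
  rcases u with i | i | i | i | i | i | ⟨c, e, g, r⟩ | ⟨c, e, g, r⟩ | ⟨c, e, g, r⟩ |
      ⟨c, e, g, r⟩ | ⟨c, e, r⟩ | ⟨c, e, r⟩ <;>
    rcases w with j | j | j | j | j | j | ⟨c', e', g', r'⟩ | ⟨c', e', g', r'⟩ | ⟨c', e', g', r'⟩ |
      ⟨c', e', g', r'⟩ | ⟨c', e', r'⟩ | ⟨c', e', r'⟩ <;>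
    simp only [IsCore, Up, AboveZ, topVertices, level2Vertices, level0Vertices, Set.mem_ofPred_eq,
      reduceCtorEq, and_false, exists_false, or_false, false_or,
      GadgetVertex.s.injEq, GadgetVertex.t.injEq] at h hw
  · have := hρ c e
    grind
  · have := hρ c e
    grind

end Reference

/-! ### Comparison of a popular matching with the reference matching -/

/-- The index `ρ` of the reference matching on a level 3 gadget, and the transfer `k` along the edge
between `s_ρ` and `t_ρ`. If possible, this edge is not in `m`, so that it cannot cause a loss.
Otherwise `k` directs the loss of the edge to `s_0` or `t_0`, whichever can pay for it. -/
def IsChoice (m : GadgetVertex V C → GadgetVertex V C) (c : C) (e : Bool) (r : Fin 4) (k : ℤ) :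
    Prop :=
  r ≠ 0 ∧ (m (s c e r) ≠ t c e r ∨ (∀ i ≠ 0, m (s c e i) = t c e i) ∧
    (r = 1 ∧ k = 2 ∧ (m (s c e 0) = q c e 0 0 ∨ m (s c e 0) = q c e 1 0) ∨
      m (s c e 0) ≠ q c e 0 0 ∧ m (s c e 0) ≠ q c e 1 0 ∧
        (r = 3 ∧ k = -2 ∧ (m (t c e 0) = p c e 2 1 ∨ m (t c e 0) = p c e 1 1) ∨
          k = 0 ∧ m (t c e 0) ≠ p c e 2 1 ∧ m (t c e 0) ≠ p c e 1 1)))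

theorem exists_isChoice (m : GadgetVertex V C → GadgetVertex V C) (c : C) (e : Bool) :
    ∃ r k, IsChoice m c e r k := by
  by_cases h : ∃ r ≠ 0, m (s c e r) ≠ t c e r
  · obtain ⟨r, hr, h⟩ := h
    exact ⟨r, 0, hr, Or.inl h⟩
  · push Not at h
    by_cases hq : m (s c e 0) = q c e 0 0 ∨ m (s c e 0) = q c e 1 0
    · exact ⟨1, 2, by decide, Or.inr ⟨h, Or.inl ⟨rfl, rfl, hq⟩⟩⟩
    · push Not at hq
      by_cases hp : m (t c e 0) = p c e 2 1 ∨ m (t c e 0) = p c e 1 1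
      · exact ⟨3, -2, by decide, Or.inr ⟨h, Or.inr ⟨hq.1, hq.2, Or.inl ⟨rfl, rfl, hp⟩⟩⟩⟩
      · push Not at hp
        exact ⟨1, 0, by decide, Or.inr ⟨h, Or.inr ⟨hq.1, hq.2, Or.inr ⟨rfl, hp⟩⟩⟩⟩

section Comparison

variable {φ : MonotoneFormula V C} {P : Preferences (GadgetVertex V C)}
  {m : GadgetVertex V C → GadgetVertex V C}

/-- The `D`-gadget has a perfect matching that contains all edges of `m` inside the gadget. -/
theorem exists_matching_d [Fintype (GadgetVertex V C)] (hm : P.IsPopularInvolution m) :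
    ∃ ν : Fin 4 → Fin 4, (∀ i, ν (ν i) = i) ∧ (∀ i, ν i ≠ i) ∧ ∀ i j, m (d i) = d j → ν i = j := by
  have hs : ∀ i j, m (d i) = d j → m (d j) = d i := fun i j h => by rw [← h, hm.invol]
  have hne : ∀ i, m (d i) ≠ d i := fun i => hm.ne _
  have hf : ∀ i j k, m (d i) = d j → m (d i) = d k → j = k := fun i j k h h' => by
    simpa using h.symm.trans h'
  by_cases h1 : m (d 0) = d 1 ∨ m (d 2) = d 3
  · refine ⟨![1, 0, 3, 2], by decide, by decide, fun i j h => ?_⟩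
    fin_cases i <;> fin_cases j <;> simp <;> grind
  · by_cases h2 : m (d 0) = d 2 ∨ m (d 1) = d 3
    · refine ⟨![2, 3, 0, 1], by decide, by decide, fun i j h => ?_⟩
      fin_cases i <;> fin_cases j <;> simp <;> grind
    · refine ⟨![3, 2, 1, 0], by decide, by decide, fun i j h => ?_⟩
      fin_cases i <;> fin_cases j <;> simp <;> grind

variable (τ : Bool) (ρ : C → Bool → Fin 4) (k : C → Bool → ℤ) (ν : Fin 4 → Fin 4)

/-- The votes gained by the reference matching at the two ends of the edge of `m` at `u`. -/
noncomputable def edgeVotes (P : Preferences (GadgetVertex V C))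
    (m : GadgetVertex V C → GadgetVertex V C) (u : GadgetVertex V C) : ℤ :=
  P.vote m u (refPartner τ ρ ν u) + P.vote m (m u) (refPartner τ ρ ν (m u))

open Classical in
/-- The transfer along the edges between `s_ρ` and `t_ρ`. -/
noncomputable def blockTransfer (m : GadgetVertex V C → GadgetVertex V C) :
    GadgetVertex V C → ℤ
  | s c e r => if r = ρ c e ∧ m (s c e r) = t c e r then k c e else 0
  | t c e r => if r = ρ c e ∧ m (t c e r) = s c e r then - k c e else 0
  | _ => 0

open Classical in
/-- The transfer of votes along the edges of `m`: core vertices receive the votes of their partners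
that are not core vertices. -/
noncomputable def transfer (P : Preferences (GadgetVertex V C))
    (m : GadgetVertex V C → GadgetVertex V C) (u : GadgetVertex V C) : ℤ :=
  if (IsCore u ↔ IsCore (m u)) then blockTransfer ρ k m u
  else if IsCore u then edgeVotes τ ρ ν P m u else - edgeVotes τ ρ ν P m u

/-- What a vertex collects: the votes at its edge of `m` and the transfer. -/
noncomputable def share (P : Preferences (GadgetVertex V C))
    (m : GadgetVertex V C → GadgetVertex V C) (u : GadgetVertex V C) : ℤ :=
  edgeVotes τ ρ ν P m u + transfer τ ρ k ν P m u

variable {τ ρ k ν}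

/-- The vertices of the level 3 edges of `m` that block the reference matching. -/
def IsBlockEnd (ρ : C → Bool → Fin 4) (m : GadgetVertex V C → GadgetVertex V C)
    (u : GadgetVertex V C) : Prop :=
  ∃ c e, m (s c e (ρ c e)) = t c e (ρ c e) ∧ (u = s c e (ρ c e) ∨ u = t c e (ρ c e))

theorem not_isCore_of_isBlockEnd (hρ : ∀ c e, ρ c e ≠ 0) {u : GadgetVertex V C}
    (hu : IsBlockEnd ρ m u) : ¬ IsCore u := by
  obtain ⟨c, e, -, rfl | rfl⟩ := hu <;> exact hρ c e

theorem up_s_zero {c : C} {e : Bool} {w : GadgetVertex V C} (hρ : ρ c e ≠ 0)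
    (h : Up φ τ ρ (s c e 0) w) :
    1 < ρ c e ∧ (w = t c e 1 ∨ w = q c e 0 0) ∨ 2 < ρ c e ∧ (w = t c e 2 ∨ w = q c e 1 0) := by
  simpa [Up, Ne.symm hρ] using h

theorem up_t_zero {c : C} {e : Bool} {w : GadgetVertex V C} (hρ : ρ c e ≠ 0)
    (h : Up φ τ ρ (t c e 0) w) :
    ρ c e < 3 ∧ (w = s c e 3 ∨ w = p c e 2 1) ∨ ρ c e < 2 ∧ (w = s c e 2 ∨ w = p c e 1 1) := by
  simpa [Up, Ne.symm hρ] using h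

variable [Fintype (GadgetVertex V C)]

theorem edgeVotes_partner (hm : P.IsPopularInvolution m) (u : GadgetVertex V C) :
    edgeVotes τ ρ ν P m (m u) = edgeVotes τ ρ ν P m u := by
  simp only [edgeVotes, hm.invol]
  ring

theorem blockTransfer_partner (hm : P.IsPopularInvolution m) (u : GadgetVertex V C) :
    blockTransfer ρ k m (m u) = - blockTransfer ρ k m u := by
  have key : ∀ u, blockTransfer ρ k m u ≠ 0 →
      blockTransfer ρ k m (m u) = - blockTransfer ρ k m u := by
    intro u hu
    cases u with
    | s c e r =>
      by_cases h : r = ρ c e ∧ m (s c e r) = t c e r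
      · have h' : m (t c e r) = s c e r := by rw [← h.2, hm.invol]
        rw [h.2]
        simp only [blockTransfer]
        rw [if_pos ⟨h.1, h'⟩, if_pos h]
      · simp [blockTransfer, h] at hu
    | t c e r =>
      by_cases h : r = ρ c e ∧ m (t c e r) = s c e r
      · have h' : m (s c e r) = t c e r := by rw [← h.2, hm.invol]
        rw [h.2]
        simp only [blockTransfer]
        rw [if_pos ⟨h.1, h'⟩, if_pos h, neg_neg]
      · simp [blockTransfer, h] at hu
    | _ => simp [blockTransfer] at hu
  by_cases hu : blockTransfer ρ k m u = 0
  · by_contra hne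
    have h := key (m u) (by rw [hu] at hne; simpa using hne)
    rw [hm.invol, hu] at h
    rw [hu] at hne
    exact hne (by linarith)
  · exact key u hu

theorem transfer_partner (hm : P.IsPopularInvolution m) (u : GadgetVertex V C) :
    transfer τ ρ k ν P m (m u) = - transfer τ ρ k ν P m u := by
  unfold transfer
  rw [edgeVotes_partner hm, blockTransfer_partner hm, hm.invol]
  by_cases h1 : IsCore u <;> by_cases h2 : IsCore (m u) <;> simp [h1, h2]

/-- The hypotheses of the comparison: `m` is popular in an instance constructed from `φ`, and the
reference matching is one whose edges in the `D`-gadget include those of `m`. -/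
structure IsComparison (φ : MonotoneFormula V C)
    (P : Preferences (GadgetVertex V C)) (m : GadgetVertex V C → GadgetVertex V C)
    (ρ : C → Bool → Fin 4) (ν : Fin 4 → Fin 4) : Prop where
  inst : IsInstanceOf φ P
  pop : P.IsPopularInvolution m
  ne_zero : ∀ c e, ρ c e ≠ 0
  invol : ∀ i, ν (ν i) = i
  ne : ∀ i, ν i ≠ i
  extend : ∀ i j, m (d i) = d j → ν i = j

theorem vote_refPartner (H : IsComparison φ P m ρ ν) (u : GadgetVertex V C) :
    m u = refPartner τ ρ ν u ∧ P.vote m u (refPartner τ ρ ν u) = 0 ∨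
    ¬ m u = refPartner τ ρ ν u ∧ Up φ τ ρ u (m u) ∧ P.vote m u (refPartner τ ρ ν u) = -1 ∨
    ¬ m u = refPartner τ ρ ν u ∧ ¬ Up φ τ ρ u (m u) ∧ P.vote m u (refPartner τ ρ ν u) = 1 := by
  by_cases h : m u = refPartner τ ρ ν u
  · left
    exact ⟨h, by rw [← h]; exact vote_partner u⟩
  · right
    by_cases hd : ∃ i, u = d i
    · obtain ⟨i, rfl⟩ := hd
      have hout : ∀ j, m (d i) ≠ d j := fun j hj => h (by rw [hj, refPartner, H.extend i j hj])
      exact Or.inr ⟨h, id, vote_eq_one (H.inst.d_prefers (H.ne i) hout)⟩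
    · push Not at hd
      have hup := H.inst.prefers_refPartner_iff (τ := τ) (ν := ν) H.ne_zero (w := m u) hd
      by_cases hu : Up φ τ ρ u (m u)
      · exact Or.inl ⟨h, hu, vote_eq_neg_one (Ne.symm h) (prefers_asymm (hup.2 hu))⟩
      · refine Or.inr ⟨h, hu, vote_eq_one ?_⟩
        have hne : refPartner τ ρ ν u ≠ u := by
          cases u with
          | d i => exact absurd rfl (hd i)
          | z i => fin_cases i <;> simp [refPartner]
          | _ => simp [refPartner]
        exact (prefers_total hne (H.pop.ne u) (Ne.symm h)).resolve_right fun h' => hu (hup.1 h')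

theorem partner_eq_refPartner_iff (hm : P.IsPopularInvolution m) (hν : ∀ i, ν (ν i) = i)
    (u : GadgetVertex V C) :
    m (m u) = refPartner τ ρ ν (m u) ↔ m u = refPartner τ ρ ν u := by
  rw [hm.invol]
  constructor
  · intro h
    rw [h, refPartner_refPartner _ _ hν, ← h]
  · intro h
    rw [h, refPartner_refPartner _ _ hν]

theorem edgeVotes_nonneg (H : IsComparison φ P m ρ ν) {u : GadgetVertex V C}
    (hu : ¬ IsBlockEnd ρ m u) :
    0 ≤ edgeVotes τ ρ ν P m u := by
  have h1 := vote_refPartner (τ := τ) H u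
  have h2 := vote_refPartner (τ := τ) H (m u)
  rw [partner_eq_refPartner_iff H.pop H.invol, H.pop.invol] at h2
  have h3 : ¬ (Up φ τ ρ u (m u) ∧ Up φ τ ρ (m u) u) := by
    rintro ⟨h, h'⟩
    obtain ⟨c, e, ⟨h1, h2⟩ | ⟨h1, h2⟩⟩ := h.eq_of_symm h' H.ne_zero
    · exact hu ⟨c, e, by rw [← h1, h2], Or.inl h1⟩
    · exact hu ⟨c, e, by rw [← h2, H.pop.invol, h1], Or.inr h1⟩
  unfold edgeVotes
  grind

theorem blockTransfer_eq_zero (hm : P.IsPopularInvolution m) {u : GadgetVertex V C}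
    (hu : ¬ IsBlockEnd ρ m u) :
    blockTransfer ρ k m u = 0 := by
  cases u with
  | s c e r =>
    have : ¬ (r = ρ c e ∧ m (s c e r) = t c e r) := by
      rintro ⟨rfl, h⟩
      exact hu ⟨c, e, h, Or.inl rfl⟩
    simp [blockTransfer, this]
  | t c e r =>
    have : ¬ (r = ρ c e ∧ m (t c e r) = s c e r) := by
      rintro ⟨rfl, h⟩
      exact hu ⟨c, e, by rw [← h, hm.invol], Or.inr rfl⟩
    simp [blockTransfer, this]
  | _ => rfl

theorem share_nonneg (H : IsComparison φ P m ρ ν) {u : GadgetVertex V C} (hu : ¬ IsBlockEnd ρ m u) :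
    0 ≤ share τ ρ k ν P m u := by
  have h := edgeVotes_nonneg (τ := τ) H hu
  have h' := blockTransfer_eq_zero (k := k) H.pop hu
  unfold share transfer
  split_ifs <;> linarith

/-- A core vertex whose partner is also one gains two votes together with it. -/
theorem edgeVotes_of_isCore (H : IsComparison φ P m ρ ν) {u : GadgetVertex V C} (hu : IsCore u)
    (hmu : IsCore (m u))
    (hne : m u ≠ refPartner τ ρ ν u) : edgeVotes τ ρ ν P m u = 2 := by
  have h1 := vote_refPartner (τ := τ) H u
  have h2 := vote_refPartner (τ := τ) H (m u)
  rw [partner_eq_refPartner_iff H.pop H.invol, H.pop.invol] at h2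
  have h3 := not_up_of_isCore (φ := φ) (τ := τ) (u := u) hmu H.ne_zero
  have h4 := not_up_of_isCore (φ := φ) (τ := τ) (u := m u) hu H.ne_zero
  unfold edgeVotes
  grind

/-- A core vertex whose partner is not one collects four votes, or none if it prefers its partner
to its partner in the reference matching. -/
theorem share_of_isCore (H : IsComparison φ P m ρ ν) {u : GadgetVertex V C} (hu : IsCore u)
    (hmu : ¬ IsCore (m u))
    (hne : m u ≠ refPartner τ ρ ν u) :
    Up φ τ ρ u (m u) ∧ share τ ρ k ν P m u = 0 ∨
    ¬ Up φ τ ρ u (m u) ∧ share τ ρ k ν P m u = 4 := by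
  have h1 := vote_refPartner (τ := τ) H u
  have h2 := vote_refPartner (τ := τ) H (m u)
  rw [partner_eq_refPartner_iff H.pop H.invol, H.pop.invol] at h2
  have h4 := not_up_of_isCore (φ := φ) (τ := τ) (u := m u) hu H.ne_zero
  simp only [share, transfer, hu, hmu]
  unfold edgeVotes
  grind

theorem share_of_isCore_of_isCore (H : IsComparison φ P m ρ ν) {u : GadgetVertex V C}
    (hu : IsCore u) (hmu : IsCore (m u))
    (hne : m u ≠ refPartner τ ρ ν u) :
    share τ ρ k ν P m u = 2 := by
  have h := edgeVotes_of_isCore (τ := τ) H hu hmu hne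
  have h' := blockTransfer_eq_zero (k := k) H.pop
    (fun h => not_isCore_of_isBlockEnd H.ne_zero h hu)
  simp [share, transfer, hu, hmu, h, h']

/-- The two ends of a level 3 edge that blocks the reference matching share a loss of four votes. -/
theorem share_of_isBlockEnd (H : IsComparison φ P m ρ ν) {c : C} {e : Bool} (h : m (s c e
    (ρ c e)) = t c e (ρ c e)) :
    share τ ρ k ν P m (s c e (ρ c e)) = -2 + k c e ∧
    share τ ρ k ν P m (t c e (ρ c e)) = -2 - k c e := by
  have h' : m (t c e (ρ c e)) = s c e (ρ c e) := by rw [← h, H.pop.invol]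
  have h1 := vote_refPartner (τ := τ) H (s c e (ρ c e))
  have h2 := vote_refPartner (τ := τ) H (t c e (ρ c e))
  have hs : edgeVotes τ ρ ν P m (s c e (ρ c e)) = -2 := by
    simp only [h, h', Up, refPartner, Equiv.swap_apply_right] at h1 h2
    simp [H.ne_zero c e] at h1 h2
    simp only [edgeVotes, h]
    simp only [refPartner, Equiv.swap_apply_right]
    rw [h1, h2]
    norm_num
  have ht : edgeVotes τ ρ ν P m (t c e (ρ c e)) = -2 := by
    rw [← h, edgeVotes_partner H.pop, hs]
  simp only [share, hs, ht, transfer, h, h', blockTransfer, IsCore, iff_self, if_true, true_and,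
    and_self]
  ring

/-- In a gadget whose edge between `s_ρ` and `t_ρ` causes a loss, the vertices `s_0` and `t_0`
make up for it. -/
theorem share_of_block (H : IsComparison φ P m ρ ν) {c : C} {e : Bool}
    (hk : IsChoice m c e (ρ c e) (k c e)) (h : m (s c e (ρ c e)) = t c e (ρ c e)) :
    2 + k c e ≤ share τ ρ k ν P m (s c e 0) ∧ 2 - k c e ≤ share τ ρ k ν P m (t c e 0) := by
  have hρ := H.ne_zero c e
  have hs0 : 0 ≤ share τ ρ k ν P m (s c e 0) :=
    share_nonneg H fun h => not_isCore_of_isBlockEnd H.ne_zero h rfl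
  have ht0 : 0 ≤ share τ ρ k ν P m (t c e 0) :=
    share_nonneg H fun h => not_isCore_of_isBlockEnd H.ne_zero h rfl
  have hns : m (s c e 0) ≠ refPartner τ ρ ν (s c e 0) := fun h' => by
    simp only [refPartner, Equiv.swap_apply_left, ← h] at h'
    have := congrArg m h'
    simp only [H.pop.invol, GadgetVertex.s.injEq] at this
    exact hρ this.2.2.symm
  have hnt : m (t c e 0) ≠ refPartner τ ρ ν (t c e 0) := fun h' => by
    simp only [refPartner, Equiv.swap_apply_left] at h'
    have := congrArg m h'
    simp only [H.pop.invol, h, GadgetVertex.t.injEq] at this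
    exact hρ this.2.2.symm
  have hcs := fun hc => share_of_isCore (τ := τ) (k := k) H (u := s c e 0) rfl hc hns
  have hct := fun hc => share_of_isCore (τ := τ) (k := k) H (u := t c e 0) rfl hc hnt
  have hCs := fun hc => share_of_isCore_of_isCore (τ := τ) (k := k) H (u := s c e 0) rfl hc hns
  have hCt := fun hc => share_of_isCore_of_isCore (τ := τ) (k := k) H (u := t c e 0) rfl hc hnt
  have hus := fun hu => up_s_zero (φ := φ) (τ := τ) (w := m (s c e 0)) hρ hu
  have hut := fun hu => up_t_zero (φ := φ) (τ := τ) (w := m (t c e 0)) hρ hu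
  obtain ⟨-, hk | ⟨hall, ⟨hr, hk, hq⟩ | ⟨hq, hq', ⟨hr, hk, hp⟩ | ⟨hk, hp, hp'⟩⟩⟩⟩ := hk
  · exact absurd h hk
  · have hc : ¬ IsCore (m (s c e 0)) := by rcases hq with hq | hq <;> rw [hq] <;> exact id
    rcases hcs hc with ⟨hu, -⟩ | ⟨-, h4⟩
    · have := hus hu
      simp [hr] at this
    · rw [hk]; constructor <;> linarith
  · have hc : ¬ IsCore (m (t c e 0)) := by rcases hp with hp | hp <;> rw [hp] <;> exact id
    rcases hct hc with ⟨hu, -⟩ | ⟨-, h4⟩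
    · have := hut hu
      simp [hr] at this
    · rw [hk]; constructor <;> linarith
  · have hts : ∀ i ≠ 0, m (s c e 0) ≠ t c e i := fun i hi h' => by
      rw [← hall i hi] at h'
      have := congrArg m h'
      simp only [H.pop.invol, GadgetVertex.s.injEq] at this
      exact hi this.2.2.symm
    have hst : ∀ i ≠ 0, m (t c e 0) ≠ s c e i := fun i hi h' => by
      have := congrArg m h'
      rw [H.pop.invol, hall i hi, GadgetVertex.t.injEq] at this
      exact hi this.2.2.symm
    have h1 : ¬ Up φ τ ρ (s c e 0) (m (s c e 0)) := fun hu => by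
      rcases hus hu with ⟨-, h | h⟩ | ⟨-, h | h⟩
      · exact hts 1 (by decide) h
      · exact hq h
      · exact hts 2 (by decide) h
      · exact hq' h
    have h2 : ¬ Up φ τ ρ (t c e 0) (m (t c e 0)) := fun hu => by
      rcases hut hu with ⟨-, h | h⟩ | ⟨-, h | h⟩
      · exact hst 3 (by decide) h
      · exact hp h
      · exact hst 2 (by decide) h
      · exact hp' h
    rw [hk]
    constructor
    · by_cases hc : IsCore (m (s c e 0))
      · linarith [hCs hc]
      · rcases hcs hc with ⟨hu, -⟩ | ⟨-, h4⟩
        · exact absurd hu h1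
        · linarith
    · by_cases hc : IsCore (m (t c e 0))
      · linarith [hCt hc]
      · rcases hct hc with ⟨hu, -⟩ | ⟨-, h4⟩
        · exact absurd hu h2
        · linarith

theorem share_add_share_nonneg (H : IsComparison φ P m ρ ν)
    (hk : ∀ c e, IsChoice m c e (ρ c e) (k c e)) (u : GadgetVertex V C) :
    0 ≤ share τ ρ k ν P m u + share τ ρ k ν P m (refPartner τ ρ ν u) := by
  have key : ∀ u, IsBlockEnd ρ m u →
      0 ≤ share τ ρ k ν P m u + share τ ρ k ν P m (refPartner τ ρ ν u) := by
    rintro u ⟨c, e, h, rfl | rfl⟩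
    · have h1 := share_of_block (τ := τ) H (hk c e) h
      have h2 := share_of_isBlockEnd (τ := τ) (k := k) H h
      simp only [refPartner, Equiv.swap_apply_right]
      linarith
    · have h1 := share_of_block (τ := τ) H (hk c e) h
      have h2 := share_of_isBlockEnd (τ := τ) (k := k) H h
      simp only [refPartner, Equiv.swap_apply_right]
      linarith
  by_cases h1 : IsBlockEnd ρ m u
  · exact key u h1
  · by_cases h2 : IsBlockEnd ρ m (refPartner τ ρ ν u)
    · have := key _ h2
      rw [refPartner_refPartner _ _ H.invol] at this
      linarith
    · have := share_nonneg (τ := τ) (k := k) H h1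
      have := share_nonneg (τ := τ) (k := k) H h2
      linarith

theorem share_add_share_eq_zero (H : IsComparison φ P m ρ ν)
    (hk : ∀ c e, IsChoice m c e (ρ c e) (k c e)) (u : GadgetVertex V C) :
    share τ ρ k ν P m u + share τ ρ k ν P m (refPartner τ ρ ν u) = 0 :=
  H.pop.collected_eq_zero _ (refPartner_refPartner τ ρ H.invol) _ _
    (transfer_partner (k := k) H.pop) (fun _ => rfl) (share_add_share_nonneg H hk) u

theorem share_eq_zero (H : IsComparison φ P m ρ ν)
    (hk : ∀ c e, IsChoice m c e (ρ c e) (k c e)) {u : GadgetVertex V C}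
    (h1 : ¬ IsBlockEnd ρ m u) (h2 : ¬ IsBlockEnd ρ m (refPartner τ ρ ν u)) :
    share τ ρ k ν P m u = 0 := by
  have := share_add_share_eq_zero (τ := τ) H hk u
  have := share_nonneg (τ := τ) (k := k) H h1
  have := share_nonneg (τ := τ) (k := k) H h2
  linarith

/-- The edges of a popular matching at the `D`-gadget stay inside the gadget. -/
theorem exists_partner_d (H : IsComparison φ P m ρ ν)
    (hk : ∀ c e, IsChoice m c e (ρ c e) (k c e)) (i : Fin 4) : ∃ j, m (d i) = d j := by
  by_contra! hi
  have hb : ∀ i, ¬ IsBlockEnd ρ m (d i) := fun i h => not_isCore_of_isBlockEnd H.ne_zero h trivial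
  have h0 := share_eq_zero (τ := false) (k := k) H hk (hb i) (hb (ν i))
  by_cases hc : IsCore (m (d i))
  · have := share_of_isCore_of_isCore (τ := false) (k := k) H (u := d i) trivial hc (hi _)
    linarith
  · rcases share_of_isCore (τ := false) (k := k) H (u := d i) trivial hc (hi _) with ⟨h, -⟩ | ⟨-, h⟩
    · exact h
    · linarith

theorem partner_s_zero (H : IsComparison φ P m ρ ν)
    (hk : ∀ c e, IsChoice m c e (ρ c e) (k c e)) (c : C) (e : Bool) :
    IsCore (m (s c e 0)) ∨ (∃ r ≠ 0, m (s c e 0) = t c e r) ∨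
      m (s c e 0) = q c e 0 0 ∨ m (s c e 0) = q c e 1 0 := by
  have hρ := H.ne_zero c e
  by_cases hc : IsCore (m (s c e 0))
  · exact Or.inl hc
  right
  by_cases hn : m (s c e 0) = refPartner false ρ ν (s c e 0)
  · exact Or.inl ⟨ρ c e, hρ, by rw [hn]; simp [refPartner]⟩
  have hup : Up φ false ρ (s c e 0) (m (s c e 0)) →
      (∃ r ≠ 0, m (s c e 0) = t c e r) ∨ m (s c e 0) = q c e 0 0 ∨ m (s c e 0) = q c e 1 0 := by
    intro hu
    rcases up_s_zero hρ hu with ⟨-, h | h⟩ | ⟨-, h | h⟩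
    · exact Or.inl ⟨1, by decide, h⟩
    · exact Or.inr (Or.inl h)
    · exact Or.inl ⟨2, by decide, h⟩
    · exact Or.inr (Or.inr h)
  rcases share_of_isCore (k := k) H (u := s c e 0) rfl hc hn with ⟨hu, -⟩ | ⟨-, h4⟩
  · exact hup hu
  · by_cases hb : m (s c e (ρ c e)) = t c e (ρ c e)
    · have h1 := (share_of_isBlockEnd (τ := false) (k := k) H hb).2
      have h2 := share_add_share_eq_zero (τ := false) H hk (t c e (ρ c e))
      simp only [refPartner, Equiv.swap_apply_right] at h2
      have hk2 : k c e = 2 := by linarith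
      obtain ⟨-, h | ⟨-, ⟨-, -, hq⟩ | ⟨-, -, ⟨-, h, -⟩ | ⟨h, -⟩⟩⟩⟩ := hk c e
      · exact absurd hb h
      · exact Or.inr hq
      · rw [h] at hk2; norm_num at hk2
      · rw [h] at hk2; norm_num at hk2
    · have h0 : share false ρ k ν P m (s c e 0) = 0 := by
        refine share_eq_zero H hk (fun h => not_isCore_of_isBlockEnd H.ne_zero h rfl) ?_
        simp only [refPartner, Equiv.swap_apply_left]
        rintro ⟨c', e', h, h' | h'⟩
        · simp at h'
        · simp only [GadgetVertex.t.injEq] at h'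
          obtain ⟨rfl, rfl, -⟩ := h'
          exact hb h
      linarith

theorem partner_t_zero (H : IsComparison φ P m ρ ν)
    (hk : ∀ c e, IsChoice m c e (ρ c e) (k c e)) (c : C) (e : Bool) :
    IsCore (m (t c e 0)) ∨ (∃ r ≠ 0, m (t c e 0) = s c e r) ∨
      m (t c e 0) = p c e 2 1 ∨ m (t c e 0) = p c e 1 1 := by
  have hρ := H.ne_zero c e
  by_cases hc : IsCore (m (t c e 0))
  · exact Or.inl hc
  right
  by_cases hn : m (t c e 0) = refPartner false ρ ν (t c e 0)
  · exact Or.inl ⟨ρ c e, hρ, by rw [hn]; simp [refPartner]⟩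
  have hup : Up φ false ρ (t c e 0) (m (t c e 0)) →
      (∃ r ≠ 0, m (t c e 0) = s c e r) ∨ m (t c e 0) = p c e 2 1 ∨ m (t c e 0) = p c e 1 1 := by
    intro hu
    rcases up_t_zero hρ hu with ⟨-, h | h⟩ | ⟨-, h | h⟩
    · exact Or.inl ⟨3, by decide, h⟩
    · exact Or.inr (Or.inl h)
    · exact Or.inl ⟨2, by decide, h⟩
    · exact Or.inr (Or.inr h)
  rcases share_of_isCore (k := k) H (u := t c e 0) rfl hc hn with ⟨hu, -⟩ | ⟨-, h4⟩
  · exact hup hu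
  · by_cases hb : m (s c e (ρ c e)) = t c e (ρ c e)
    · have h1 := (share_of_isBlockEnd (τ := false) (k := k) H hb).1
      have h2 := share_add_share_eq_zero (τ := false) H hk (s c e (ρ c e))
      simp only [refPartner, Equiv.swap_apply_right] at h2
      have hk2 : k c e = -2 := by linarith
      obtain ⟨-, h | ⟨-, ⟨-, h, -⟩ | ⟨-, -, ⟨-, -, hp⟩ | ⟨h, -⟩⟩⟩⟩ := hk c e
      · exact absurd hb h
      · rw [h] at hk2; norm_num at hk2
      · exact Or.inr hp
      · rw [h] at hk2; norm_num at hk2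
    · have h0 : share false ρ k ν P m (t c e 0) = 0 := by
        refine share_eq_zero H hk (fun h => not_isCore_of_isBlockEnd H.ne_zero h rfl) ?_
        simp only [refPartner, Equiv.swap_apply_left]
        rintro ⟨c', e', h, h' | h'⟩
        · simp only [GadgetVertex.s.injEq] at h'
          obtain ⟨rfl, rfl, -⟩ := h'
          exact hb h
        · simp at h'
      linarith

/-- Away from the core, exactly one end of an edge of a popular matching prefers the edge to the
reference matching, unless the edge belongs to both matchings. -/
theorem up_or_up (H : IsComparison φ P m ρ ν)
    (hk : ∀ c e, IsChoice m c e (ρ c e) (k c e)) {u : GadgetVertex V C} (hu : ¬ IsCore u)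
    (hmu : ¬ IsCore (m u)) :
    m u = refPartner τ ρ ν u ∨ Up φ τ ρ u (m u) ∨ Up φ τ ρ (m u) u := by
  by_cases hb : IsBlockEnd ρ m u
  · right; left
    obtain ⟨c, e, h, rfl | rfl⟩ := hb
    · rw [h]; simp [Up]
    · rw [← h, H.pop.invol, h]; simp [Up]
  · have hb' : ¬ IsBlockEnd ρ m (refPartner τ ρ ν u) := by
      rintro ⟨c, e, h, h' | h'⟩
      · have := congrArg (refPartner τ ρ ν) h'
        rw [refPartner_refPartner _ _ H.invol] at this
        rw [this] at hu
        exact hu (by simp [refPartner, IsCore])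
      · have := congrArg (refPartner τ ρ ν) h'
        rw [refPartner_refPartner _ _ H.invol] at this
        rw [this] at hu
        exact hu (by simp [refPartner, IsCore])
    have h0 := share_eq_zero (τ := τ) H hk hb hb'
    have h1 := vote_refPartner (τ := τ) H u
    have h2 := vote_refPartner (τ := τ) H (m u)
    have h3 := blockTransfer_eq_zero (k := k) H.pop hb
    rw [H.pop.invol] at h2
    simp only [share, transfer, hu, hmu, iff_self, if_true, h3, edgeVotes] at h0
    grind

/-- The restrictions that the comparison with the reference matching puts on a popular matching. -/
theorem IsInstanceOf.exists_restrictions (hP : IsInstanceOf φ P) (hm : P.IsPopularInvolution m) :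
    (∀ i, ∃ j, m (d i) = d j) ∧
    (∀ c e, IsCore (m (s c e 0)) ∨ (∃ r ≠ 0, m (s c e 0) = t c e r) ∨
      m (s c e 0) = q c e 0 0 ∨ m (s c e 0) = q c e 1 0) ∧
    (∀ c e, IsCore (m (t c e 0)) ∨ (∃ r ≠ 0, m (t c e 0) = s c e r) ∨
      m (t c e 0) = p c e 2 1 ∨ m (t c e 0) = p c e 1 1) ∧
    ∃ ρ ν, (∀ c e, ρ c e ≠ 0) ∧ ∀ τ u, ¬ IsCore u → ¬ IsCore (m u) →
      m u = refPartner τ ρ ν u ∨ Up φ τ ρ u (m u) ∨ Up φ τ ρ (m u) u := by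
  obtain ⟨ν, h1, h2, h3⟩ := exists_matching_d hm
  choose ρ k hk using exists_isChoice m
  have H : IsComparison φ P m ρ ν := ⟨hP, hm, fun c e => (hk c e).1, h1, h2, h3⟩
  exact ⟨exists_partner_d H hk, partner_s_zero H hk, partner_t_zero H hk, ρ, ν, H.ne_zero,
    fun τ u hu hmu => up_or_up H hk hu hmu⟩

end Comparison

/-! ### The `D`-gadget in a popular matching -/

section DGadget

variable {φ : MonotoneFormula V C} {P : Preferences (GadgetVertex V C)}
  {m : GadgetVertex V C → GadgetVertex V C}

/-- `u` prefers every vertex of the `D`-gadget to its partner. -/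
def PrefersD (P : Preferences (GadgetVertex V C)) (m : GadgetVertex V C → GadgetVertex V C)
    (u : GadgetVertex V C) : Prop :=
  ∀ j, P.Prefers u (d j) (m u)

theorem IsInstanceOf.prefersD (hP : IsInstanceOf φ P) {u : GadgetVertex V C}
    (A : List (GadgetVertex V C)) {B : List (GadgetVertex V C)}
    (h : ∀ L₁ L₂ L₀, listHead φ L₁ L₂ L₀ u = A ++ (blockD ++ B))
    (hw : m u ∉ u :: A) (hd : (m u).gadget ≠ .D) : PrefersD P m u :=
  hP.prefers_d A h hw fun i hi => hd (by rw [hi]; rfl)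

variable [Fintype (GadgetVertex V C)]

/-- `m` is a popular perfect matching of an instance constructed from `φ`. -/
structure IsPopularIn (φ : MonotoneFormula V C) (P : Preferences (GadgetVertex V C))
    (m : GadgetVertex V C → GadgetVertex V C) : Prop where
  inst : IsInstanceOf φ P
  pop : P.IsPopularInvolution m

theorem IsPopularIn.exists_partner_d (H : IsPopularIn φ P m) (i : Fin 4) : ∃ j, m (d i) = d j :=
  (H.inst.exists_restrictions H.pop).1 i

/-- The `D`-gadget is always unstable. -/
theorem IsPopularIn.exists_blocking_d (H : IsPopularIn φ P m) :
    ∃ i j k l, m (d i) = d k ∧ m (d j) = d l ∧ 2 ≤ P.gain m (d i, d j) ∧ [i, j, k, l].Nodup := by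
  have hs : ∀ i j, m (d i) = d j → m (d j) = d i := fun i j h => by rw [← h, H.pop.invol]
  have hne : ∀ i, m (d i) ≠ d i := fun i => H.pop.ne _
  have hf : ∀ i j k, m (d i) = d j → m (d i) = d k → j = k := fun i j k h h' => by
    simpa using h.symm.trans h'
  obtain ⟨j, hj⟩ := H.exists_partner_d 0
  obtain ⟨i₁, h₁⟩ := H.exists_partner_d 1
  obtain ⟨i₂, h₂⟩ := H.exists_partner_d 2
  fin_cases j
  · exact absurd hj (hne 0)
  · have h23 : i₂ = 3 := by
      fin_cases i₂ <;> simp at hj h₁ h₂ ⊢ <;> grind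
    subst h23
    refine ⟨1, 3, 0, 2, hs _ _ hj, hs _ _ h₂, two_le_gain ?_ ?_, by decide⟩
    · rw [show m (d 1) = d 0 from hs _ _ hj]
      exact H.inst.prefers [d 2] (fun _ _ _ => rfl) (by simp)
    · rw [hs _ _ h₂]
      exact H.inst.prefers [] (fun _ _ _ => rfl) (by simp)
  · have h13 : i₁ = 3 := by
      fin_cases i₁ <;> simp at hj h₁ h₂ ⊢ <;> grind
    subst h13
    refine ⟨1, 2, 3, 0, h₁, hs _ _ hj, two_le_gain ?_ ?_, by decide⟩
    · rw [h₁]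
      exact H.inst.prefers [] (fun _ _ _ => rfl) (by simp)
    · rw [show m (d 2) = d 0 from hs _ _ hj]
      exact H.inst.prefers [d 3] (fun _ _ _ => rfl) (by simp)
  · have h12 : i₁ = 2 := by
      fin_cases i₁ <;> simp at hj h₁ h₂ ⊢ <;> grind
    subst h12
    refine ⟨2, 3, 1, 0, hs _ _ h₁, hs _ _ hj, two_le_gain ?_ ?_, by decide⟩
    · rw [hs _ _ h₁]
      exact H.inst.prefers [] (fun _ _ _ => rfl) (by simp)
    · rw [show m (d 3) = d 0 from hs _ _ hj]
      exact H.inst.prefers [d 1] (fun _ _ _ => rfl) (by simp)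

/-- The `D`-gadget joins two vertices that prefer it to their partners by an alternating path that
gains two votes. -/
theorem IsPopularIn.sum_gain_add_two_le (H : IsPopularIn φ P m) (E : List
    (GadgetVertex V C × GadgetVertex V C))
    (F : List (GadgetVertex V C)) {u v : GadgetVertex V C} (hu : PrefersD P m u)
    (hv : PrefersD P m v) (hE : (u :: v :: ends E).Nodup)
    (hD : ∀ w ∈ u :: v :: ends E, w.gadget ≠ .D)
    (hF : ∀ w ∈ u :: v :: ends E, m w ∈ u :: v :: ends E ∨ m w ∈ F) :
    (E.map (P.gain m)).sum + 2 ≤ F.length := by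
  obtain ⟨i, j, k, l, hik, hjl, hg, hn⟩ := H.exists_blocking_d
  have hki : m (d k) = d i := by rw [← hik, H.pop.invol]
  have hlj : m (d l) = d j := by rw [← hjl, H.pop.invol]
  have hD' : ∀ i, d i ∉ u :: v :: ends E := fun i h => hD _ h rfl
  have h := H.pop.sum_gain_le ((d i, d j) :: (u, d k) :: (v, d l) :: E) F ?_ ?_
  · have h1 := gain_nonneg_left (hu k)
    have h2 := gain_nonneg_left (hv l)
    simp only [List.map_cons, List.sum_cons] at h
    linarith
  · have hi := hD' i
    have hj := hD' j
    have hk := hD' k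
    have hl := hD' l
    simp only [List.mem_cons, not_or] at hi hj hk hl
    simp only [List.nodup_cons, List.mem_cons, not_or, List.not_mem_nil, not_false_eq_true] at hn hE
    simp only [ends_cons, List.nodup_cons, List.mem_cons, not_or, GadgetVertex.d.injEq]
    grind
  · intro w hw
    simp only [ends_cons, List.mem_cons] at hw hF ⊢
    rcases hw with rfl | rfl | rfl | rfl | rfl | rfl | hw
    · simp [hik]
    · simp [hjl]
    · have := hF w (by simp); tauto
    · simp [hki]
    · have := hF w (by simp); tauto
    · simp [hlj]
    · have := hF w (by simp [hw]); tauto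

theorem IsPopularIn.not_prefersD_partner (H : IsPopularIn φ P m) {u : GadgetVertex V C}
    (hu : PrefersD P m u) :
    ¬ PrefersD P m (m u) := by
  intro hv
  have hD : ∀ u, PrefersD P m u → u.gadget ≠ .D := by
    intro u hu
    cases u with
    | d i => exact fun _ => (hu i).mem_left rfl
    | _ => simp [gadget]
  have h := H.sum_gain_add_two_le [] [] hu hv (by simpa using (H.pop.ne u).symm)
    (by simp [hD _ hu, hD _ hv]) (by simp [H.pop.invol])
  simp at h

theorem IsPopularIn.eq_of_partner (H : IsPopularIn φ P m) {u v w : GadgetVertex V C}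
    (h : m u = w) (h' : m v = w) : u = v := by
  rw [← H.pop.invol u, h, ← h', H.pop.invol]

theorem IsPopularIn.partner_comm (H : IsPopularIn φ P m) {u v : GadgetVertex V C} (h : m u = v) :
    m v = u := by
  rw [← h, H.pop.invol]

theorem IsPopularIn.partner_ne_d (H : IsPopularIn φ P m) {u : GadgetVertex V C}
    (hu : u.gadget ≠ .D) : (m u).gadget ≠ .D := by
  intro h
  obtain ⟨i, hi⟩ : ∃ i, m u = d i := by
    cases hw : m u <;> simp_all [gadget]
  obtain ⟨j, hj⟩ := H.exists_partner_d i
  rw [← H.partner_comm hi, hj] at hu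
  exact hu rfl

/-- No edge of a popular matching joins two core vertices outside the `D`-gadget. -/
theorem IsPopularIn.not_isCore_partner (H : IsPopularIn φ P m) {u : GadgetVertex V C}
    (hu : u.gadget ≠ .D) (hc : IsCore u) : ¬ IsCore (m u) := by
  intro hc'
  have key : ∀ u, IsCore u → IsCore (m u) → u.gadget ≠ .D → PrefersD P m u := by
    intro u hc hc' hu
    have hne := H.pop.ne u
    have hd := H.partner_ne_d hu
    cases u with
    | s c e r =>
      obtain rfl : r = 0 := hc
      refine H.inst.prefersD (A := [_, _, _, _, _]) (fun _ _ _ => rfl) ?_ hd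
      cases hw : m (s c e 0) <;> simp_all [IsCore]
    | t c e r =>
      obtain rfl : r = 0 := hc
      refine H.inst.prefersD (A := [_, _, _, _, _]) (fun _ _ _ => rfl) ?_ hd
      cases hw : m (t c e 0) <;> simp_all [IsCore]
    | d i => exact absurd rfl hu
    | _ => exact hc.elim
  exact H.not_prefersD_partner (key u hc hc' hu)
    (key _ hc' (by rwa [H.pop.invol]) (H.partner_ne_d hu))

theorem IsPopularIn.partner_s_zero (H : IsPopularIn φ P m) (c : C) (e : Bool) :
    (∃ r ≠ 0, m (s c e 0) = t c e r) ∨ m (s c e 0) = q c e 0 0 ∨ m (s c e 0) = q c e 1 0 :=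
  ((H.inst.exists_restrictions H.pop).2.1 c e).resolve_left
    (H.not_isCore_partner (by simp [gadget]) rfl)

theorem IsPopularIn.partner_t_zero (H : IsPopularIn φ P m) (c : C) (e : Bool) :
    (∃ r ≠ 0, m (t c e 0) = s c e r) ∨ m (t c e 0) = p c e 2 1 ∨ m (t c e 0) = p c e 1 1 :=
  ((H.inst.exists_restrictions H.pop).2.2.1 c e).resolve_left
    (H.not_isCore_partner (by simp [gadget]) rfl)

end DGadget

/-! ### Possible partners in a popular matching -/

section Partners

variable [Fintype (GadgetVertex V C)] {φ : MonotoneFormula V C}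
  {P : Preferences (GadgetVertex V C)} {m : GadgetVertex V C → GadgetVertex V C}

/-- The edges of a popular matching between a vertex `u` outside the core and a core vertex `w`. -/
def IsCoreEdge (u w : GadgetVertex V C) : Prop :=
  ∃ c e, w = s c e 0 ∧ ((∃ r ≠ 0, u = t c e r) ∨ u = q c e 0 0 ∨ u = q c e 1 0) ∨
    w = t c e 0 ∧ ((∃ r ≠ 0, u = s c e r) ∨ u = p c e 2 1 ∨ u = p c e 1 1)

theorem IsPopularIn.exists_restrictions (H : IsPopularIn φ P m) :
    ∃ ρ ν, (∀ c e, ρ c e ≠ 0) ∧ ∀ τ u, ¬ IsCore u →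
      m u = refPartner τ ρ ν u ∨ Up φ τ ρ u (m u) ∨ Up φ τ ρ (m u) u ∨ IsCoreEdge u (m u) := by
  obtain ⟨-, -, -, ρ, ν, hρ, h⟩ := H.inst.exists_restrictions H.pop
  refine ⟨ρ, ν, hρ, fun τ u hu => ?_⟩
  by_cases hc : IsCore (m u)
  · right; right; right
    have hd : u.gadget ≠ .D := by
      cases u with
      | d i => exact absurd trivial hu
      | _ => simp [gadget]
    have hd' := H.partner_ne_d hd
    cases hw : m u with
    | s c e r =>
      rw [hw] at hc
      obtain rfl : r = 0 := hc
      refine ⟨c, e, Or.inl ⟨rfl, ?_⟩⟩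
      simpa [H.partner_comm hw] using H.partner_s_zero c e
    | t c e r =>
      rw [hw] at hc
      obtain rfl : r = 0 := hc
      refine ⟨c, e, Or.inr ⟨rfl, ?_⟩⟩
      simpa [H.partner_comm hw] using H.partner_t_zero c e
    | d i => rw [hw] at hd'; exact absurd rfl hd'
    | _ => rw [hw] at hc; exact hc.elim
  · rcases h τ u hu hc with h | h | h <;> simp [h]

theorem IsPopularIn.partner_x' (H : IsPopularIn φ P m) (i : V) :
    m (x' i) = y' i ∨ m (x' i) = y i := by
  obtain ⟨ρ, ν, hρ, h⟩ := H.exists_restrictions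
  have h := h true (x' i) id
  cases hw : m (x' i) <;> rw [hw] at h <;>
    simp [refPartner, Up, IsCoreEdge, AboveZ, topVertices, level2Vertices, level0Vertices]
      at h ⊢ <;> tauto

theorem IsPopularIn.partner_y' (H : IsPopularIn φ P m) (i : V) :
    m (y' i) = x' i ∨ m (y' i) = x i := by
  obtain ⟨ρ, ν, hρ, h⟩ := H.exists_restrictions
  have h := h false (y' i) id
  cases hw : m (y' i) <;> rw [hw] at h <;>
    simp [refPartner, Up, IsCoreEdge, AboveZ, topVertices, level2Vertices, level0Vertices]
      at h ⊢ <;> tauto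

theorem IsPopularIn.partner_x (H : IsPopularIn φ P m) (i : V) :
    m (x i) = y i ∨ m (x i) = y' i ∨ (∃ c e g, φ.var c (g + 2) = i ∧ m (x i) = q c e g 2) ∨
      ∃ j, m (x i) = z j := by
  obtain ⟨ρ, ν, hρ, h⟩ := H.exists_restrictions
  have h := h false (x i) id
  cases hw : m (x i) <;> rw [hw] at h <;>
    simp [refPartner, Up, IsCoreEdge, AboveZ, topVertices, level2Vertices, level0Vertices]
      at h ⊢ <;> tauto

theorem IsPopularIn.partner_y (H : IsPopularIn φ P m) (i : V) :
    m (y i) = x i ∨ m (y i) = x' i ∨ (∃ c e g, φ.var c (g + 1) = i ∧ m (y i) = p c e g 2) ∨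
      ∃ j, m (y i) = z j := by
  obtain ⟨ρ, ν, hρ, h⟩ := H.exists_restrictions
  have h := h false (y i) id
  cases hw : m (y i) <;> rw [hw] at h <;>
    simp [refPartner, Up, IsCoreEdge, AboveZ, topVertices, level2Vertices, level0Vertices]
      at h ⊢ <;> tauto

theorem IsPopularIn.partner_a (H : IsPopularIn φ P m) (c : C) (e : Bool) (g : Fin 3) (r : Fin 2) :
    (∃ r', m (a c e g r) = b c e g r') ∨ ∃ j, m (a c e g r) = z j := by
  obtain ⟨ρ, ν, hρ, h⟩ := H.exists_restrictions
  have h := h false (a c e g r) id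
  cases hw : m (a c e g r) <;> rw [hw] at h <;>
    simp [refPartner, Up, IsCoreEdge, AboveZ, topVertices, level2Vertices, level0Vertices]
      at h ⊢
  tauto

theorem IsPopularIn.partner_b (H : IsPopularIn φ P m) (c : C) (e : Bool) (g : Fin 3) (r : Fin 2) :
    (∃ r', m (b c e g r) = a c e g r') ∨ ∃ j, m (b c e g r) = z j := by
  obtain ⟨ρ, ν, hρ, h⟩ := H.exists_restrictions
  have h := h true (b c e g r) id
  cases hw : m (b c e g r) <;> rw [hw] at h <;>
    simp [refPartner, Up, IsCoreEdge, AboveZ, topVertices, level2Vertices, level0Vertices]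
      at h ⊢
  tauto

theorem IsPopularIn.partner_p_zero (H : IsPopularIn φ P m) (c : C) (e : Bool) (g : Fin 3) :
    m (p c e g 0) = q c e g 0 ∨ m (p c e g 0) = q c e g 2 := by
  obtain ⟨ρ, ν, hρ, h⟩ := H.exists_restrictions
  have h := h true (p c e g 0) id
  cases hw : m (p c e g 0) <;> rw [hw] at h <;>
    simp [refPartner, Up, IsCoreEdge, AboveZ, topVertices, level2Vertices, level0Vertices]
      at h ⊢
  tauto

theorem IsPopularIn.partner_p_one (H : IsPopularIn φ P m) (c : C) (e : Bool) (g : Fin 3) :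
    m (p c e g 1) = q c e g 1 ∨ m (p c e g 1) = q c e g 2 ∨ m (p c e g 1) = t c e 0 ∧ g ≠ 0 ∨
      ∃ j, m (p c e g 1) = z j := by
  obtain ⟨ρ, ν, hρ, h⟩ := H.exists_restrictions
  have h := h true (p c e g 1) id
  cases hw : m (p c e g 1) <;> rw [hw] at h <;>
    simp [refPartner, Up, IsCoreEdge, AboveZ, topVertices, level2Vertices, level0Vertices]
      at h ⊢ <;> grind

theorem IsPopularIn.partner_p_two (H : IsPopularIn φ P m) (c : C) (e : Bool) (g : Fin 3) :
    (∃ r, m (p c e g 2) = q c e g r) ∨ m (p c e g 2) = y (φ.var c (g + 1)) := by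
  obtain ⟨ρ, ν, hρ, h⟩ := H.exists_restrictions
  have h := h true (p c e g 2) id
  cases hw : m (p c e g 2) <;> rw [hw] at h <;>
    simp [refPartner, Up, IsCoreEdge, AboveZ, topVertices, level2Vertices, level0Vertices]
      at h ⊢ <;> grind

theorem IsPopularIn.partner_q_zero (H : IsPopularIn φ P m) (c : C) (e : Bool) (g : Fin 3) :
    m (q c e g 0) = p c e g 0 ∨ m (q c e g 0) = p c e g 2 ∨ m (q c e g 0) = s c e 0 ∧ g ≠ 2 ∨
      ∃ j, m (q c e g 0) = z j := by
  obtain ⟨ρ, ν, hρ, h⟩ := H.exists_restrictions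
  have h := h true (q c e g 0) id
  cases hw : m (q c e g 0) <;> rw [hw] at h <;>
    simp [refPartner, Up, IsCoreEdge, AboveZ, topVertices, level2Vertices, level0Vertices]
      at h ⊢ <;> grind

theorem IsPopularIn.partner_q_one (H : IsPopularIn φ P m) (c : C) (e : Bool) (g : Fin 3) :
    m (q c e g 1) = p c e g 1 ∨ m (q c e g 1) = p c e g 2 := by
  obtain ⟨ρ, ν, hρ, h⟩ := H.exists_restrictions
  have h := h true (q c e g 1) id
  cases hw : m (q c e g 1) <;> rw [hw] at h <;>
    simp [refPartner, Up, IsCoreEdge, AboveZ, topVertices, level2Vertices, level0Vertices]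
      at h ⊢
  tauto

theorem IsPopularIn.partner_q_two (H : IsPopularIn φ P m) (c : C) (e : Bool) (g : Fin 3) :
    (∃ r, m (q c e g 2) = p c e g r) ∨ m (q c e g 2) = x (φ.var c (g + 2)) := by
  obtain ⟨ρ, ν, hρ, h⟩ := H.exists_restrictions
  have h := h true (q c e g 2) id
  cases hw : m (q c e g 2) <;> rw [hw] at h <;>
    simp [refPartner, Up, IsCoreEdge, AboveZ, topVertices, level2Vertices, level0Vertices]
      at h ⊢ <;> grind

theorem IsPopularIn.partner_s (H : IsPopularIn φ P m) (c : C) (e : Bool) {r : Fin 4} (hr : r ≠ 0) :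
    m (s c e r) = t c e r ∨ m (s c e r) = t c e 0 := by
  obtain ⟨ρ, ν, hρ, h⟩ := H.exists_restrictions
  have h := h true (s c e r) hr
  cases hw : m (s c e r) <;> rw [hw] at h <;>
    simp [refPartner, Up, IsCoreEdge, AboveZ, topVertices, level2Vertices, level0Vertices, hr,
      Equiv.swap_apply_def] at h ⊢
  grind

theorem IsPopularIn.partner_t (H : IsPopularIn φ P m) (c : C) (e : Bool) {r : Fin 4} (hr : r ≠ 0) :
    m (t c e r) = s c e r ∨ m (t c e r) = s c e 0 := by
  obtain ⟨ρ, ν, hρ, h⟩ := H.exists_restrictions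
  have h := h true (t c e r) hr
  cases hw : m (t c e r) <;> rw [hw] at h <;>
    simp [refPartner, Up, IsCoreEdge, AboveZ, topVertices, level2Vertices, level0Vertices, hr,
      Equiv.swap_apply_def] at h ⊢
  grind

theorem IsPopularIn.partner_z (H : IsPopularIn φ P m) (i : Fin 6) :
    (∃ j, m (z i) = z j) ∨ (i = 0 ∨ i = 1) ∧
      (m (z i) ∈ topVertices ∨ m (z i) ∈ level2Vertices ∨ m (z i) ∈ level0Vertices) := by
  obtain ⟨ρ, ν, hρ, h⟩ := H.exists_restrictions
  have h := h true (z i) id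
  by_cases hz : ∃ j, m (z i) = z j
  · exact Or.inl hz
  right
  rcases h with h | h | h | ⟨c, e, h | h⟩
  · exact absurd ⟨_, h⟩ hz
  · simp only [not_exists] at hz
    simpa [Up, AboveZ, hz] using h
  · cases hw : m (z i) <;> rw [hw] at h <;> simp [Up] at h
    exact absurd ⟨_, hw⟩ hz
  · simp at h
  · simp at h

end Partners

/-! ### All edges of a popular matching stay inside the gadgets -/

section Inside

variable [Fintype (GadgetVertex V C)] {φ : MonotoneFormula V C}
  {P : Preferences (GadgetVertex V C)} {m : GadgetVertex V C → GadgetVertex V C}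

/-- A vertex matched to the `Z`-gadget from outside prefers the `D`-gadget. -/
theorem IsPopularIn.prefersD_of_z (H : IsPopularIn φ P m) {i : Fin 6}
    (h : m (z i) ∈ topVertices ∨ m (z i) ∈ level2Vertices ∨ m (z i) ∈ level0Vertices) :
    PrefersD P m (m (z i)) := by
  have hd : (m (m (z i))).gadget ≠ .D := by rw [H.pop.invol]; simp [gadget]
  rcases h with ⟨j, h | h⟩ | ⟨c, e, g, h | h⟩ | ⟨c, e, g, r, h | h⟩ <;> rw [h] at hd ⊢ <;>
    have h' := H.partner_comm h
  · exact H.inst.prefersD [_, _] (fun _ _ _ => rfl) (by simp [h']) hd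
  · exact H.inst.prefersD [_, _] (fun _ _ _ => rfl) (by simp [h']) hd
  · exact H.inst.prefersD [_, _] (fun _ _ _ => rfl) (by simp [h']) hd
  · exact H.inst.prefersD [_, _] (fun _ _ _ => rfl) (by simp [h']) hd
  · fin_cases r
    · exact H.inst.prefersD (u := a c e g 0) [_, _, _] (fun _ _ _ => rfl) (by simp_all) hd
    · exact H.inst.prefersD (u := a c e g 1) [_, _] (fun _ _ _ => rfl) (by simp_all) hd
  · fin_cases r
    · exact H.inst.prefersD (u := b c e g 0) [_, _, _] (fun _ _ _ => rfl) (by simp_all) hd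
    · exact H.inst.prefersD (u := b c e g 1) [_, _] (fun _ _ _ => rfl) (by simp_all) hd

/-- The partner `k` of the vertex `i` of the `Z`-gadget is compatible with the partners in `l`. -/
def FitsZ (l : List (Fin 6 × Fin 6)) (i k : Fin 6) : Prop :=
  k ≠ i ∧ ∀ e ∈ l, e.2 = i ↔ k = e.1

instance (l : List (Fin 6 × Fin 6)) (i k : Fin 6) : Decidable (FitsZ l i k) := by
  unfold FitsZ; infer_instance

theorem not_fitsZ : ∀ i i' : Fin 6, i = 0 ∧ i' = 1 ∨ i = 1 ∧ i' = 0 → ∀ k, FitsZ [] i k → k ≠ i' →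
    ∀ k₂, FitsZ [(i, k)] 2 k₂ → k₂ ≠ i' → ∀ k₃, FitsZ [(i, k), (2, k₂)] 3 k₃ → k₃ ≠ i' →
    ∀ k₄, FitsZ [(i, k), (2, k₂), (3, k₃)] 4 k₄ → k₄ ≠ i' →
    ∀ k₅, FitsZ [(i, k), (2, k₂), (3, k₃), (4, k₄)] 5 k₅ → k₅ = i' := by
  decide +kernel

theorem IsPopularIn.fitsZ (H : IsPopularIn φ P m) {i k : Fin 6} (h : m (z i) = z k)
    {l : List (Fin 6 × Fin 6)} (hl : ∀ e ∈ l, m (z e.1) = z e.2) : FitsZ l i k := by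
  refine ⟨fun hk => H.pop.ne (z i) (by rw [h, hk]), fun e he => ⟨fun h' => ?_, fun h' => ?_⟩⟩
  · have := H.partner_comm (hl e he)
    rw [h', h] at this
    simpa using this
  · have := H.partner_comm h
    rw [h', hl e he] at this
    simpa using this

/-- If one of `z 0`, `z 1` is matched inside the `Z`-gadget, so is the other one, by parity. -/
theorem IsPopularIn.partner_z_of_partner_z (H : IsPopularIn φ P m) {i i' : Fin 6}
    (hi : i = 0 ∧ i' = 1 ∨ i = 1 ∧ i' = 0) (h : ∃ j, m (z i) = z j) : ∃ j, m (z i') = z j := by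
  have hz : ∀ i : Fin 6, i ≠ 0 → i ≠ 1 → ∃ j, m (z i) = z j := fun i h0 h1 =>
    (H.partner_z i).resolve_right (by tauto)
  by_contra hn
  have hn' : ∀ i j, m (z i) = z j → j ≠ i' := fun i j hj hj' =>
    hn ⟨i, H.partner_comm (by rw [hj, hj'])⟩
  obtain ⟨k, hk⟩ := h
  obtain ⟨k₂, h₂⟩ := hz 2 (by decide) (by decide)
  obtain ⟨k₃, h₃⟩ := hz 3 (by decide) (by decide)
  obtain ⟨k₄, h₄⟩ := hz 4 (by decide) (by decide)
  obtain ⟨k₅, h₅⟩ := hz 5 (by decide) (by decide)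
  exact hn' _ _ h₅ (not_fitsZ i i' hi k (H.fitsZ hk (by simp)) (hn' _ _ hk)
    k₂ (H.fitsZ h₂ (by simp [hk])) (hn' _ _ h₂) k₃ (H.fitsZ h₃ (by simp [hk, h₂])) (hn' _ _ h₃)
    k₄ (H.fitsZ h₄ (by simp [hk, h₂, h₃])) (hn' _ _ h₄) k₅ (H.fitsZ h₅ (by simp [hk, h₂, h₃, h₄])))

theorem IsPopularIn.exists_partner_z (H : IsPopularIn φ P m) (i : Fin 6) : ∃ j, m (z i) = z j := by
  have key : ∃ j, m (z 0) = z j := by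
    by_contra h0
    have h1 : ¬ ∃ j, m (z 1) = z j := fun h =>
      h0 (H.partner_z_of_partner_z (Or.inr ⟨rfl, rfl⟩) h)
    have hu := ((H.partner_z 0).resolve_left h0).2
    have hv := ((H.partner_z 1).resolve_left h1).2
    obtain ⟨j, hj⟩ := (H.partner_z 4).resolve_right fun h => absurd h.1 (by decide)
    have hj4 : m (z j) = z 4 := H.partner_comm hj
    have hj0 : j ≠ 0 := fun h => h0 ⟨4, by rw [← h, hj4]⟩
    have hj1 : j ≠ 1 := fun h => h1 ⟨4, by rw [← h, hj4]⟩
    have hj4' : j ≠ 4 := fun h => H.pop.ne (z 4) (by rw [hj, h])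
    have hz : ∀ {i k}, (¬ ∃ j, m (z i) = z j) → m (z i) ≠ z k := fun h h' => h ⟨_, h'⟩
    -- `z 0` prefers `z 4` to its partner outside, since `z 4` is its first choice
    have g1 : 0 ≤ P.gain m (z 0, z 4) :=
      gain_nonneg_left (H.inst.prefers_first (fun _ _ _ => rfl) (hz h0) (hz h0).symm)
    have g2 : 0 ≤ P.gain m (z 1, z j) := by
      have : j = 2 ∨ j = 3 ∨ j = 5 := by lia
      rcases this with rfl | rfl | rfl
      · exact gain_nonneg_right (H.inst.prefers [z 0] (fun _ _ _ => rfl) (by simp [hj4]))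
      · exact gain_nonneg_right (H.inst.prefers [] (fun _ _ _ => rfl) (by simp [hj4]))
      · exact gain_nonneg_left (H.inst.prefers_first (fun _ _ _ => rfl) (hz h1) (hz h1).symm)
    have hne : m (z 0) ≠ m (z 1) := fun h => by
      have := congrArg m h
      simp [H.pop.invol] at this
    have h := H.sum_gain_add_two_le [(z 0, z 4), (z 1, z j)] [] (H.prefersD_of_z hu)
      (H.prefersD_of_z hv) ?_ ?_ ?_
    · simp only [List.map_cons, List.map_nil, List.sum_cons, List.sum_nil, List.length_nil,
        Nat.cast_zero] at h
      linarith
    · simp only [ends_cons, ends_nil, List.nodup_cons, List.mem_cons, not_or, List.not_mem_nil,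
        not_false_eq_true, List.nodup_nil, and_true, GadgetVertex.z.injEq]
      simp only [hz h0, hz h1, hne, not_false_eq_true, true_and, Ne.symm hj0, Ne.symm hj1,
        Ne.symm hj4']
      decide
    · intro w hw
      simp only [ends_cons, ends_nil, List.mem_cons, List.not_mem_nil, or_false] at hw
      rcases hw with rfl | rfl | rfl | rfl | rfl | rfl
      · exact H.partner_ne_d (by simp [gadget])
      · exact H.partner_ne_d (by simp [gadget])
      all_goals simp [gadget]
    · simp [H.pop.invol, hj, hj4]
  by_cases hi : i = 0 ∨ i = 1
  · rcases hi with rfl | rfl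
    · exact key
    · exact H.partner_z_of_partner_z (Or.inl ⟨rfl, rfl⟩) key
  · exact (H.partner_z i).resolve_right (by tauto)

/-- The vote of `z i` for `z j` against a matching `k` of the `Z`-gadget. -/
def voteZ (k : Fin 6 → Fin 6) (i j : Fin 6) : ℤ :=
  if j = k i then 0 else if List.Sublist [j, k i] (orderZ i) then 1 else -1

/-- Three perfect matchings of the `Z`-gadget. -/
def matchingsZ : List (List (Fin 6 × Fin 6)) :=
  [[(0, 4), (1, 5), (2, 3)], [(0, 1), (2, 4), (3, 5)], [(0, 2), (1, 3), (4, 5)]]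

/-- A perfect matching of the `Z`-gadget without the edge between `z 0` and `z 1` loses against
another one. -/
theorem exists_better_matchingZ : ∀ k₀, FitsZ [] 0 k₀ → k₀ ≠ 1 → ∀ k₁, FitsZ [(0, k₀)] 1 k₁ →
    ∀ k₂, FitsZ [(0, k₀), (1, k₁)] 2 k₂ → ∀ k₃, FitsZ [(0, k₀), (1, k₁), (2, k₂)] 3 k₃ →
    ∀ k₄, FitsZ [(0, k₀), (1, k₁), (2, k₂), (3, k₃)] 4 k₄ →
    ∀ k₅, FitsZ [(0, k₀), (1, k₁), (2, k₂), (3, k₃), (4, k₄)] 5 k₅ →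
    ∃ E ∈ matchingsZ, 0 < (E.map fun e =>
      voteZ ![k₀, k₁, k₂, k₃, k₄, k₅] e.1 e.2 + voteZ ![k₀, k₁, k₂, k₃, k₄, k₅] e.2 e.1).sum := by
  decide +kernel

theorem IsPopularIn.partner_z_zero (H : IsPopularIn φ P m) : m (z 0) = z 1 := by
  choose k hk using H.exists_partner_z
  by_contra h0
  have hf : ∀ i, ![k 0, k 1, k 2, k 3, k 4, k 5] i = k i := by
    intro i; fin_cases i <;> rfl
  obtain ⟨E, hE, hpos⟩ := exists_better_matchingZ (k 0) (H.fitsZ (hk 0) (by simp))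
    (fun h => h0 (by rw [hk, h])) (k 1) (H.fitsZ (hk 1) (by simp [hk])) (k 2)
    (H.fitsZ (hk 2) (by simp [hk])) (k 3) (H.fitsZ (hk 3) (by simp [hk])) (k 4)
    (H.fitsZ (hk 4) (by simp [hk])) (k 5) (H.fitsZ (hk 5) (by simp [hk]))
  have hv : ∀ i j, voteZ ![k 0, k 1, k 2, k 3, k 4, k 5] i j ≤ P.vote m (z i) (z j) := by
    intro i j
    unfold voteZ
    rw [hf]
    split_ifs with h1 h2
    · rw [h1, ← hk, vote_partner]
    · exact (vote_eq_one (by rw [hk]; exact H.inst.prefers_z h2)).ge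
    · exact neg_one_le_vote _ _
  have h := H.pop.sum_gain_le (E.map fun e => (z e.1, z e.2)) [] ?_ ?_
  · have h' : (E.map fun e => voteZ ![k 0, k 1, k 2, k 3, k 4, k 5] e.1 e.2 +
        voteZ ![k 0, k 1, k 2, k 3, k 4, k 5] e.2 e.1).sum ≤
        ((E.map fun e => (z e.1, z e.2)).map (P.gain m)).sum := by
      rw [List.map_map]
      exact List.sum_le_sum fun e _ => add_le_add (hv _ _) (hv _ _)
    simp only [List.length_nil, Nat.cast_zero] at h
    linarith
  · simp only [matchingsZ, List.mem_cons, List.not_mem_nil, or_false] at hE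
    rcases hE with rfl | rfl | rfl <;> simp
  · intro u hu
    left
    have : ∀ E ∈ matchingsZ, ∀ i, i ∈ ends E := by decide
    have hi := this E hE
    have hz : ∀ i, z i ∈
        ends (E.map fun e => ((z e.1 : GadgetVertex V C), (z e.2 : GadgetVertex V C))) := by
      intro i
      obtain ⟨e, he, hie⟩ := List.mem_flatMap.1 (hi i)
      refine List.mem_flatMap.2 ⟨_, List.mem_map_of_mem he, ?_⟩
      simpa using hie
    obtain ⟨e, he, hue⟩ := List.mem_flatMap.1 hu
    obtain ⟨e', -, rfl⟩ := List.mem_map.1 he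
    simp only [List.mem_cons, List.not_mem_nil, or_false] at hue
    rcases hue with rfl | rfl <;> rw [hk] <;> exact hz _

theorem IsPopularIn.partner_ne_z (H : IsPopularIn φ P m) {u : GadgetVertex V C}
    (hu : u.gadget ≠ .Z) (j : Fin 6) : m u ≠ z j := by
  intro h
  obtain ⟨k, hk⟩ := H.exists_partner_z j
  rw [← H.partner_comm h, hk] at hu
  exact hu rfl

/-- In a level 1 gadget with an edge to the outside, `x` and `y` both have such an edge, and
then both pairs `x`, `y'` and `y`, `x'` block the matching. -/
theorem IsPopularIn.level1_inside (H : IsPopularIn φ P m) (i : V) :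
    m (x i) = y i ∧ m (x' i) = y' i ∨ m (x i) = y' i ∧ m (x' i) = y i := by
  have hx := H.partner_x i
  have hy := H.partner_y i
  have hx' := H.partner_x' i
  have hy' := H.partner_y' i
  have hzx := H.partner_ne_z (u := x i) (by simp [gadget])
  have hzy := H.partner_ne_z (u := y i) (by simp [gadget])
  simp only [hzx, hzy, exists_false, or_false] at hx hy
  rcases hx' with hx' | hx'
  · left
    have hy' := H.partner_comm hx'
    refine ⟨?_, hx'⟩
    rcases hx with h | h | ⟨c, e, g, -, h⟩
    · exact h
    · simpa using (H.partner_comm h).symm.trans hy'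
    rcases hy with h' | h' | ⟨c', e', g', -, h'⟩
    · simpa using h.symm.trans (H.partner_comm h')
    · simpa using hx'.symm.trans (H.partner_comm h')
    have g1 : 2 ≤ P.gain m (x i, y' i) := two_le_gain
      (H.inst.prefers [_] (fun _ _ _ => rfl) (by simp [h]))
      (H.inst.prefers [] (fun _ _ _ => rfl) (by simp [hy']))
    have g2 : 2 ≤ P.gain m (y i, x' i) := two_le_gain
      (H.inst.prefers [_] (fun _ _ _ => rfl) (by simp [h']))
      (H.inst.prefers [] (fun _ _ _ => rfl) (by simp [hx']))
    have hs := H.pop.sum_gain_le [(x i, y' i), (y i, x' i)] [m (x i), m (y i)] (by simp)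
      (by simp [hx', hy'])
    simp at hs
    linarith
  · right
    refine ⟨?_, hx'⟩
    rcases hy' with h | h
    · simpa using hx'.symm.trans (H.partner_comm h)
    · exact H.partner_comm h

/-- In a level 2 gadget, only `q_0` and `p_1` could be matched outside, namely to `s_0` and
`t_0`. -/
theorem IsPopularIn.level2_cases (H : IsPopularIn φ P m) (c : C) (e : Bool) (g : Fin 3) :
    (m (p c e g 0) = q c e g 0 ∧ m (p c e g 1) = q c e g 1 ∧ m (p c e g 2) = q c e g 2 ∨
      m (p c e g 0) = q c e g 2 ∧ m (p c e g 1) = q c e g 1 ∧ m (p c e g 2) = q c e g 0 ∨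
      m (p c e g 0) = q c e g 0 ∧ m (p c e g 1) = q c e g 2 ∧ m (p c e g 2) = q c e g 1) ∨
    m (q c e g 0) = s c e 0 ∧ m (p c e g 1) = t c e 0 ∧ g = 1 := by
  have hpx : ∀ i w, m w = x i → w.gadget = .level1 i := by
    intro i w h
    rw [← H.partner_comm h]
    rcases H.level1_inside i with ⟨h, -⟩ | ⟨h, -⟩ <;> rw [h] <;> rfl
  have hpy : ∀ i w, m w = y i → w.gadget = .level1 i := by
    intro i w h
    rw [← H.partner_comm h]
    rcases H.level1_inside i with ⟨h, -⟩ | ⟨-, h⟩ <;> rw [H.partner_comm h] <;> rfl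
  have hp2 : ∃ r, m (p c e g 2) = q c e g r := (H.partner_p_two c e g).resolve_right fun h => by
    simpa [gadget] using hpy _ _ h
  have hq2 : ∃ r, m (q c e g 2) = p c e g r := (H.partner_q_two c e g).resolve_right fun h => by
    simpa [gadget] using hpx _ _ h
  have hp0 := H.partner_p_zero c e g
  have hq1 := H.partner_q_one c e g
  have hp1 := H.partner_p_one c e g
  have hq0 := H.partner_q_zero c e g
  simp only [H.partner_ne_z (u := p c e g 1) (by simp [gadget]), exists_false, or_false] at hp1
  simp only [H.partner_ne_z (u := q c e g 0) (by simp [gadget]), exists_false, or_false] at hq0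
  have hc : ∀ i j, m (p c e g i) = q c e g j ↔ m (q c e g j) = p c e g i := fun i j =>
    ⟨H.partner_comm, H.partner_comm⟩
  have hf : ∀ i j k, m (p c e g i) = q c e g j → m (p c e g i) = q c e g k → j = k :=
    fun i j k h h' => by simpa using h.symm.trans h'
  have hf' : ∀ i j k, m (p c e g i) = q c e g k → m (p c e g j) = q c e g k → i = j :=
    fun i j k h h' => by simpa using H.eq_of_partner h h'
  simp only [← hc] at hq2 hq1 hq0
  obtain ⟨r, hr⟩ := hp2
  obtain ⟨r', hr'⟩ := hq2
  have hfs : ∀ i, m (p c e g i) = q c e g 0 → m (q c e g 0) ≠ s c e 0 := fun i h h' => by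
    simpa using (H.partner_comm h).symm.trans h'
  have hft : ∀ i, m (p c e g 1) = q c e g i → m (p c e g 1) ≠ t c e 0 := fun i h h' => by
    simpa using h.symm.trans h'
  have hr3 : r = 0 ∨ r = 1 ∨ r = 2 := by lia
  have hr3' : r' = 0 ∨ r' = 1 ∨ r' = 2 := by lia
  have hg : g ≠ 0 → g ≠ 2 → g = 1 := by lia
  clear hpx hpy
  rcases hr3 with rfl | rfl | rfl <;> rcases hr3' with rfl | rfl | rfl <;> grind

theorem IsPopularIn.level2_inside (H : IsPopularIn φ P m) (c : C) (e : Bool) (g : Fin 3) :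
    m (p c e g 0) = q c e g 0 ∧ m (p c e g 1) = q c e g 1 ∧ m (p c e g 2) = q c e g 2 ∨
      m (p c e g 0) = q c e g 2 ∧ m (p c e g 1) = q c e g 1 ∧ m (p c e g 2) = q c e g 0 ∨
      m (p c e g 0) = q c e g 0 ∧ m (p c e g 1) = q c e g 2 ∧ m (p c e g 2) = q c e g 1 := by
  refine (H.level2_cases c e g).resolve_right ?_
  rintro ⟨hs, ht, rfl⟩
  -- `s_0` and `t_0` could move to `t_2` and `s_2`; the `D`-gadget takes care of the vertices left
  have hs0 := H.partner_comm hs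
  have ht0 := H.partner_comm ht
  have hs2 : m (s c e 2) = t c e 2 := (H.partner_s c e (by decide)).resolve_right fun h => by
    simpa using ht0.symm.trans (H.partner_comm h)
  have ht2 := H.partner_comm hs2
  have g1 : 0 ≤ P.gain m (s c e 0, t c e 2) :=
    gain_nonneg_left (H.inst.prefers [_, _] (fun _ _ _ => rfl) (by simp [hs0]))
  have g2 : 0 ≤ P.gain m (t c e 0, s c e 2) :=
    gain_nonneg_left (H.inst.prefers [_, _] (fun _ _ _ => rfl) (by simp [ht0]))
  have hu : PrefersD P m (q c e 1 0) :=
    H.inst.prefersD [_, _] (fun _ _ _ => rfl) (by simp [hs]) (by simp [hs, gadget])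
  have hv : PrefersD P m (p c e 1 1) :=
    H.inst.prefersD [_, _] (fun _ _ _ => rfl) (by simp [ht]) (by simp [ht, gadget])
  have h := H.sum_gain_add_two_le [(s c e 0, t c e 2), (t c e 0, s c e 2)] [] hu hv
    (by simp) (by simp [gadget]) (by simp [hs, ht, hs0, ht0, hs2, ht2])
  simp at h
  linarith

/-- In a level 3 gadget, `s_0` and `t_0` are matched to `t_r` and `s_r` for some `r`. -/
theorem IsPopularIn.level3_inside (H : IsPopularIn φ P m) (c : C) (e : Bool) :
    ∃ r ≠ 0, m (s c e 0) = t c e r ∧ m (s c e r) = t c e 0 := by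
  have hq : ∀ g, m (q c e g 0) ≠ s c e 0 := fun g h => by
    rcases H.level2_inside c e g with ⟨h', -⟩ | ⟨-, -, h'⟩ | ⟨h', -⟩ <;>
      simpa using (H.partner_comm h').symm.trans h
  obtain ⟨r, hr, h⟩ := (H.partner_s_zero c e).resolve_right fun h => by
    rcases h with h | h <;> exact hq _ (H.partner_comm h)
  refine ⟨r, hr, h, (H.partner_s c e hr).resolve_left fun h' => ?_⟩
  simpa [Ne.symm hr] using H.eq_of_partner h h'

/-- Every edge of a popular matching joins two vertices of the same gadget. -/
theorem IsPopularIn.gadget_partner (H : IsPopularIn φ P m) (u : GadgetVertex V C) :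
    (m u).gadget = u.gadget := by
  have hc : ∀ {u v : GadgetVertex V C}, m u = v → v.gadget = u.gadget →
      (m u).gadget = u.gadget ∧ (m v).gadget = v.gadget := by
    intro u v h hg
    rw [H.partner_comm h, h]
    exact ⟨hg, hg.symm⟩
  cases u with
  | d i => obtain ⟨j, h⟩ := H.exists_partner_d i; rw [h]; rfl
  | z i => obtain ⟨j, h⟩ := H.exists_partner_z i; rw [h]; rfl
  | x i => rcases H.level1_inside i with ⟨h, -⟩ | ⟨h, -⟩ <;> rw [h] <;> rfl
  | x' i => rcases H.level1_inside i with ⟨-, h⟩ | ⟨-, h⟩ <;> rw [h] <;> rfl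
  | y i => rcases H.level1_inside i with ⟨h, -⟩ | ⟨-, h⟩ <;> rw [H.partner_comm h] <;> rfl
  | y' i => rcases H.level1_inside i with ⟨-, h⟩ | ⟨h, -⟩ <;> rw [H.partner_comm h] <;> rfl
  | a c e g r =>
    obtain ⟨r', h⟩ := (H.partner_a c e g r).resolve_right fun ⟨j, h⟩ =>
      H.partner_ne_z (by simp [gadget]) j h
    rw [h]; rfl
  | b c e g r =>
    obtain ⟨r', h⟩ := (H.partner_b c e g r).resolve_right fun ⟨j, h⟩ =>
      H.partner_ne_z (by simp [gadget]) j h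
    rw [h]; rfl
  | p c e g r =>
    rcases H.level2_inside c e g with ⟨h0, h1, h2⟩ | ⟨h0, h1, h2⟩ | ⟨h0, h1, h2⟩ <;>
      fin_cases r <;> first | exact (hc h0 rfl).1 | exact (hc h1 rfl).1 | exact (hc h2 rfl).1
  | q c e g r =>
    rcases H.level2_inside c e g with ⟨h0, h1, h2⟩ | ⟨h0, h1, h2⟩ | ⟨h0, h1, h2⟩ <;>
      fin_cases r <;> first | exact (hc h0 rfl).2 | exact (hc h1 rfl).2 | exact (hc h2 rfl).2
  | s c e r =>
    by_cases hr : r = 0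
    · obtain ⟨r', -, h, -⟩ := H.level3_inside c e
      rw [hr, h]; rfl
    · rcases H.partner_s c e hr with h | h <;> rw [h] <;> rfl
  | t c e r =>
    by_cases hr : r = 0
    · obtain ⟨r', -, -, h⟩ := H.level3_inside c e
      rw [hr, H.partner_comm h]; rfl
    · rcases H.partner_t c e hr with h | h <;> rw [h] <;> rfl

end Inside

/-! ### Unstable level 1 gadgets and the clauses -/

section Clauses

variable {φ : MonotoneFormula V C} {P : Preferences (GadgetVertex V C)}
  {m : GadgetVertex V C → GadgetVertex V C}

theorem aboveZ_a (c : C) (e : Bool) (g : Fin 3) (r : Fin 2) :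
    AboveZ (a c e g r : GadgetVertex V C) :=
  Or.inr (Or.inr (Or.inr (Or.inr ⟨c, e, g, r, Or.inl rfl⟩)))

theorem aboveZ_b (c : C) (e : Bool) (g : Fin 3) (r : Fin 2) :
    AboveZ (b c e g r : GadgetVertex V C) :=
  Or.inr (Or.inr (Or.inr (Or.inr ⟨c, e, g, r, Or.inr rfl⟩)))

/-- A list of disjoint edges among the vertices of levels 2 and 3 of the clause `c` and one
additional vertex `w`. The exchange gains two votes and leaves only one vertex `f` alone, not
counting the former partner of `w`. -/
structure IsArm (P : Preferences (GadgetVertex V C)) (m : GadgetVertex V C → GadgetVertex V C)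
    (c : C) (e : Bool) (w f : GadgetVertex V C)
    (E : List (GadgetVertex V C × GadgetVertex V C)) : Prop where
  nodup : (ends E).Nodup
  mem : w ∈ ends E
  gadget_eq : ∀ u ∈ ends E, u = w ∨ (∃ g, u.gadget = .level2 c e g) ∨ u.gadget = .level3 c e
  partner_mem : ∀ u ∈ ends E, m u ∈ ends E ∨ m u = f ∨ m u = m w
  two_le : 2 ≤ (E.map (P.gain m)).sum

/-- There is an arm from the gadget number `g` to one of its two vertices of level 1. -/
def HasArm (φ : MonotoneFormula V C) (P : Preferences (GadgetVertex V C))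
    (m : GadgetVertex V C → GadgetVertex V C) (c : C) (e : Bool) (g : Fin 3) : Prop :=
  (∃ f E, IsArm P m c e (x (φ.var c (g + 2))) f E) ∨ ∃ f E, IsArm P m c e (y (φ.var c (g + 1))) f E

theorem IsArm.disjoint {c : C} {w w' f f' : GadgetVertex V C}
    {E E' : List (GadgetVertex V C × GadgetVertex V C)} (h : IsArm P m c false w f E)
    (h' : IsArm P m c true w' f' E') (hw : w ∈ topVertices) (hw' : w' ∈ topVertices)
    (hne : w ≠ w') : (ends E).Disjoint (ends E') := by
  intro u hu hu'
  have key : ∀ w ∈ (topVertices : Set (GadgetVertex V C)), ∃ i, w.gadget = .level1 i := by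
    rintro _ ⟨i, rfl | rfl⟩ <;> exact ⟨i, rfl⟩
  obtain ⟨i, hi⟩ := key w hw
  obtain ⟨j, hj⟩ := key w' hw'
  rcases h.gadget_eq u hu with rfl | ⟨g, h⟩ | h <;>
    rcases h'.gadget_eq u hu' with rfl | ⟨g', h'⟩ | h' <;> simp_all

variable [Fintype (GadgetVertex V C)]

theorem IsPopularIn.isUnstable_iff (H : IsPopularIn φ P m) {M : EdgeSet (GadgetVertex V C)}
    (hM : ∀ u v, M.Adj u v ↔ m u = v) (i : V) :
    IsUnstable P M (.level1 i) ↔ m (x i) = y' i ∧ m (x' i) = y i := by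
  constructor
  · rintro ⟨u, v, hu, hv, huv, h1, h2⟩
    refine (H.level1_inside i).resolve_left ?_
    rintro ⟨h, h'⟩
    replace h1 := h1 _ ((hM _ _).2 rfl)
    replace h2 := h2 _ ((hM _ _).2 rfl)
    have hx : ∀ w, ¬ P.Prefers (x i) w (y i) := fun w hw => by
      simpa using (H.inst.prefers_iff [] fun _ _ _ => rfl).1 hw
    have hy : ∀ w, ¬ P.Prefers (y i) w (x i) := fun w hw => by
      simpa using (H.inst.prefers_iff [] fun _ _ _ => rfl).1 hw
    have key : ∀ u : GadgetVertex V C, u.gadget = .level1 i → ∀ w, P.Prefers u w (m u) →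
        u = x' i ∨ u = y' i := by
      intro u hu w hw
      cases u <;> simp only [gadget, reduceCtorEq, Gadget.level1.injEq] at hu <;> subst hu
      · rw [h] at hw; exact absurd hw (hx _)
      · simp
      · rw [H.partner_comm h] at hw; exact absurd hw (hy _)
      · simp
    rcases key u hu v h1 with rfl | rfl <;> rcases key v hv _ h2 with rfl | rfl
    · exact huv rfl
    · exact h1.ne h'.symm
    · exact h2.ne h'.symm
    · exact huv rfl
  · rintro ⟨h, h'⟩
    refine ⟨x i, y i, rfl, rfl, by simp, fun w hw => ?_, fun w hw => ?_⟩
    · rw [hM, h] at hw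
      subst hw
      exact H.inst.prefers [] (fun _ _ _ => rfl) (by simp)
    · rw [hM, H.partner_comm h'] at hw
      subst hw
      exact H.inst.prefers [] (fun _ _ _ => rfl) (by simp)

theorem IsPopularIn.two_le_gain_of_unstable (H : IsPopularIn φ P m) {i : V}
    (h : m (x i) = y' i ∧ m (x' i) = y i) : 2 ≤ P.gain m (x i, y i) :=
  two_le_gain (H.inst.prefers [] (fun _ _ _ => rfl) (by simp [h]))
    (H.inst.prefers [] (fun _ _ _ => rfl) (by simp [H.partner_comm h.2]))

theorem IsPopularIn.gain_z_zero (H : IsPopularIn φ P m) {w : GadgetVertex V C} (hw : AboveZ w) :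
    0 ≤ P.gain m (w, z 0) :=
  gain_nonneg_right (by rw [H.partner_z_zero]; exact H.inst.prefers_z_zero_iff.2 hw)

theorem IsPopularIn.gain_z_one (H : IsPopularIn φ P m) {w : GadgetVertex V C} (hw : AboveZ w) :
    0 ≤ P.gain m (z 1, w) :=
  gain_nonneg_left (by
    rw [H.partner_comm H.partner_z_zero]; exact H.inst.prefers_z_one_iff.2 hw)

theorem IsPopularIn.level0_inside (H : IsPopularIn φ P m) (c : C) (e : Bool) (g : Fin 3) :
    m (a c e g 0) = b c e g 0 ∧ m (a c e g 1) = b c e g 1 ∨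
      m (a c e g 0) = b c e g 1 ∧ m (a c e g 1) = b c e g 0 := by
  have key : ∀ r, ∃ r', m (a c e g r) = b c e g r' := fun r =>
    (H.partner_a c e g r).resolve_right fun ⟨j, h⟩ => H.partner_ne_z (by simp [gadget]) j h
  obtain ⟨r, h⟩ := key 0
  obtain ⟨r', h'⟩ := key 1
  have hne : r ≠ r' := fun hr => by
    rw [hr] at h
    simpa using H.eq_of_partner h h'
  have : r = 0 ∧ r' = 1 ∨ r = 1 ∧ r' = 0 := by lia
  rcases this with ⟨rfl, rfl⟩ | ⟨rfl, rfl⟩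
  · exact Or.inl ⟨h, h'⟩
  · exact Or.inr ⟨h, h'⟩

/-- At most one of the level 1 gadgets of a clause is unstable: the level 0 gadgets allow an
exchange that satisfies the blocking pairs of two unstable ones and passes through `z 0`, `z 1`. -/
theorem IsPopularIn.not_unstable_and_unstable (H : IsPopularIn φ P m) (c : C) (g : Fin 3)
    (hj : m (x (φ.var c (g + 1))) = y' (φ.var c (g + 1)) ∧
      m (x' (φ.var c (g + 1))) = y (φ.var c (g + 1)))
    (hk : m (x (φ.var c (g + 2))) = y' (φ.var c (g + 2)) ∧
      m (x' (φ.var c (g + 2))) = y (φ.var c (g + 2))) : False := by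
  have hjk : φ.var c (g + 1) ≠ φ.var c (g + 2) := fun h => by
    simpa using φ.var_injective c h
  have gj := H.two_le_gain_of_unstable hj
  have gk := H.two_le_gain_of_unstable hk
  have hz0 := H.partner_z_zero
  have hz1 := H.partner_comm hz0
  have hb : ∀ {w}, m (b c false g 0) = w → w = a c false g 0 →
      0 ≤ P.gain m (x' (φ.var c (g + 2)), b c false g 0) := fun h hw => gain_nonneg_right
    (H.inst.prefers [_] (fun _ _ _ => rfl) (by simp [h, hw]))
  have ha : m (a c false g 0) = b c false g 1 →
      0 ≤ P.gain m (y' (φ.var c (g + 1)), a c false g 0) := fun h => gain_nonneg_right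
    (H.inst.prefers [_] (fun _ _ _ => rfl) (by simp [h]))
  have hb' : ∀ {w}, m (b c true g 0) = w → w = a c true g 0 →
      0 ≤ P.gain m (b c true g 0, x' (φ.var c (g + 1))) := fun h hw => gain_nonneg_left
    (H.inst.prefers [_] (fun _ _ _ => rfl) (by simp [h, hw]))
  have ha' : m (a c true g 0) = b c true g 1 →
      0 ≤ P.gain m (a c true g 0, y' (φ.var c (g + 2))) := fun h => gain_nonneg_left
    (H.inst.prefers [_] (fun _ _ _ => rfl) (by simp [h]))
  have hj1 := H.partner_comm hj.1
  have hj2 := H.partner_comm hj.2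
  have hk1 := H.partner_comm hk.1
  have hk2 := H.partner_comm hk.2
  -- If the two level 0 gadgets are in the same state, both blocking pairs are used and two vertices
  -- are left alone. In the mixed cases one blocking pair suffices, as no vertex is left alone.
  rcases H.level0_inside c false g with ⟨h, -⟩ | ⟨h, -⟩ <;>
    rcases H.level0_inside c true g with ⟨h', -⟩ | ⟨h', -⟩ <;>
    have hc := H.partner_comm h <;> have hc' := H.partner_comm h'
  · have hs := H.pop.sum_gain_le [(x (φ.var c (g + 2)), y (φ.var c (g + 2))),
      (x' (φ.var c (g + 2)), b c false g 0), (a c false g 0, z 0), (z 1, a c true g 0),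
      (b c true g 0, x' (φ.var c (g + 1))), (x (φ.var c (g + 1)), y (φ.var c (g + 1)))]
      [y' (φ.var c (g + 2)), y' (φ.var c (g + 1))] (by simp [hjk.symm])
      (by simp [h, h', hc, hc', hj, hk, hj2, hk2, hz0, hz1])
    have g1 := hb hc rfl
    have g2 := hb' hc' rfl
    have g3 := H.gain_z_zero (aboveZ_a c false g 0)
    have g4 := H.gain_z_one (aboveZ_a c true g 0)
    simp at hs
    linarith
  · have hs := H.pop.sum_gain_le [(x (φ.var c (g + 2)), y (φ.var c (g + 2))),
      (x' (φ.var c (g + 2)), b c false g 0), (a c false g 0, z 0), (z 1, b c true g 1),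
      (a c true g 0, y' (φ.var c (g + 2)))]
      [] (by simp)
      (by simp [h, h', hc, hc', hk, hk1, hk2, hz0, hz1])
    have g1 := hb hc rfl
    have g2 := ha' h'
    have g3 := H.gain_z_zero (aboveZ_a c false g 0)
    have g4 := H.gain_z_one (aboveZ_b c true g 1)
    simp at hs
    linarith
  · have hs := H.pop.sum_gain_le [(x (φ.var c (g + 1)), y (φ.var c (g + 1))),
      (y' (φ.var c (g + 1)), a c false g 0), (b c false g 1, z 0), (z 1, a c true g 0),
      (b c true g 0, x' (φ.var c (g + 1)))]
      [] (by simp)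
      (by simp [h, h', hc, hc', hj, hj1, hj2, hz0, hz1])
    have g1 := ha h
    have g2 := hb' hc' rfl
    have g3 := H.gain_z_zero (aboveZ_b c false g 1)
    have g4 := H.gain_z_one (aboveZ_a c true g 0)
    simp at hs
    linarith
  · have hs := H.pop.sum_gain_le [(x (φ.var c (g + 1)), y (φ.var c (g + 1))),
      (y' (φ.var c (g + 1)), a c false g 0), (b c false g 1, z 0), (z 1, b c true g 1),
      (a c true g 0, y' (φ.var c (g + 2))), (x (φ.var c (g + 2)), y (φ.var c (g + 2)))]
      [x' (φ.var c (g + 1)), x' (φ.var c (g + 2))] (by simp [hjk])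
      (by simp [h, h', hc, hc', hj, hk, hj1, hj2, hk1, hk2, hz0, hz1])
    have g1 := ha h
    have g2 := ha' h'
    have g3 := H.gain_z_zero (aboveZ_b c false g 1)
    have g4 := H.gain_z_one (aboveZ_b c true g 1)
    simp at hs
    linarith

theorem IsPopularIn.hasArm_of_unstable (H : IsPopularIn φ P m) {c : C} {e : Bool} {g : Fin 3}
    (h : m (p c e g 0) = q c e g 2 ∧ m (p c e g 1) = q c e g 1 ∧ m (p c e g 2) = q c e g 0 ∨
      m (p c e g 0) = q c e g 0 ∧ m (p c e g 1) = q c e g 2 ∧ m (p c e g 2) = q c e g 1) :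
    HasArm φ P m c e g := by
  rcases h with ⟨h0, h1, h2⟩ | ⟨h0, h1, h2⟩ <;> have h0' := H.partner_comm h0 <;>
    have h1' := H.partner_comm h1 <;> have h2' := H.partner_comm h2
  · refine Or.inl ⟨p c e g 2, [(p c e g 0, q c e g 0), (q c e g 2, x (φ.var c (g + 2)))],
      by simp, by simp, by simp [gadget], by simp [h0, h0', h2'], ?_⟩
    have g1 : 2 ≤ P.gain m (p c e g 0, q c e g 0) := two_le_gain
      (H.inst.prefers [] (fun _ _ _ => rfl) (by simp [h0]))
      (H.inst.prefers [] (fun _ _ _ => rfl) (by simp [h2']))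
    have g2 : 0 ≤ P.gain m (q c e g 2, x (φ.var c (g + 2))) := gain_nonneg_left
      (H.inst.prefers [_] (fun _ _ _ => rfl) (by simp [h0']))
    simp
    linarith
  · refine Or.inr ⟨q c e g 2, [(p c e g 1, q c e g 1), (p c e g 2, y (φ.var c (g + 1)))],
      by simp, by simp, by simp [gadget], by simp [h1, h2, h2'], ?_⟩
    have g1 : 2 ≤ P.gain m (p c e g 1, q c e g 1) := two_le_gain
      (H.inst.prefers [] (fun _ _ _ => rfl) (by simp [h1]))
      (H.inst.prefers [] (fun _ _ _ => rfl) (by simp [h2']))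
    have g2 : 0 ≤ P.gain m (p c e g 2, y (φ.var c (g + 1))) := gain_nonneg_left
      (H.inst.prefers [_] (fun _ _ _ => rfl) (by simp [h2]))
    simp
    linarith

theorem IsPopularIn.two_le_gain_level3 (H : IsPopularIn φ P m) {c : C} {e : Bool} {r : Fin 4}
    (hr : r ≠ 0) (hs : m (s c e 0) = t c e r) (ht : m (s c e r) = t c e 0) :
    2 ≤ P.gain m (s c e r, t c e r) := by
  have hs' := H.partner_comm hs
  rcases fin_four_cases hr with rfl | rfl | rfl <;>
    exact two_le_gain (H.inst.prefers [] (fun _ _ _ => rfl) (by simp [ht]))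
      (H.inst.prefers [] (fun _ _ _ => rfl) (by simp [hs']))

/-- An arm from the blocking pair of level 3 through `t_0` and a level 2 gadget. -/
theorem IsPopularIn.hasArm_of_t (H : IsPopularIn φ P m) {c : C} {e : Bool} {g : Fin 3} {r : Fin 4}
    (hr : r ≠ 0) (hs : m (s c e 0) = t c e r) (ht : m (s c e r) = t c e 0)
    (hp : P.Prefers (t c e 0) (p c e g 1) (m (t c e 0))) (h1 : m (p c e g 1) = q c e g 1)
    (h2 : m (p c e g 2) = q c e g 2) : HasArm φ P m c e g := by
  have hs' := H.partner_comm hs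
  have ht' := H.partner_comm ht
  have h1' := H.partner_comm h1
  have h2' := H.partner_comm h2
  refine Or.inl ⟨s c e 0, [(s c e r, t c e r), (t c e 0, p c e g 1), (q c e g 1, p c e g 2),
    (q c e g 2, x (φ.var c (g + 2)))], by simp [hr], by simp, by simp [gadget],
    by simp [ht, hs', ht', h1, h1', h2, h2'], ?_⟩
  have g1 := H.two_le_gain_level3 hr hs ht
  have g2 := gain_nonneg_left hp
  have g3 : 0 ≤ P.gain m (q c e g 1, p c e g 2) := gain_nonneg_right
    (H.inst.prefers [_, _] (fun _ _ _ => rfl) (by simp [h2]))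
  have g4 : 0 ≤ P.gain m (q c e g 2, x (φ.var c (g + 2))) := gain_nonneg_left
    (H.inst.prefers [_] (fun _ _ _ => rfl) (by simp [h2']))
  simp
  linarith

/-- An arm from the blocking pair of level 3 through `s_0` and a level 2 gadget. -/
theorem IsPopularIn.hasArm_of_s (H : IsPopularIn φ P m) {c : C} {e : Bool} {g : Fin 3} {r : Fin 4}
    (hr : r ≠ 0) (hs : m (s c e 0) = t c e r) (ht : m (s c e r) = t c e 0)
    (hp : P.Prefers (s c e 0) (q c e g 0) (m (s c e 0))) (h0 : m (p c e g 0) = q c e g 0)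
    (h2 : m (p c e g 2) = q c e g 2) : HasArm φ P m c e g := by
  have hs' := H.partner_comm hs
  have ht' := H.partner_comm ht
  have h0' := H.partner_comm h0
  have h2' := H.partner_comm h2
  refine Or.inr ⟨t c e 0, [(s c e r, t c e r), (s c e 0, q c e g 0), (p c e g 0, q c e g 2),
    (p c e g 2, y (φ.var c (g + 1)))], by simp [hr], by simp, by simp [gadget],
    by simp [ht, hs, hs', h0, h0', h2, h2'], ?_⟩
  have g1 := H.two_le_gain_level3 hr hs ht
  have g2 := gain_nonneg_left hp
  have g3 : 0 ≤ P.gain m (p c e g 0, q c e g 2) := gain_nonneg_right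
    (H.inst.prefers [_, _] (fun _ _ _ => rfl) (by simp [h2']))
  have g4 : 0 ≤ P.gain m (p c e g 2, y (φ.var c (g + 1))) := gain_nonneg_left
    (H.inst.prefers [_] (fun _ _ _ => rfl) (by simp [h2]))
  simp
  linarith

/-- At most one of the three numbers `g` has no arm; which one is decided by level 3. -/
theorem IsPopularIn.exists_hasArm (H : IsPopularIn φ P m) (c : C) (e : Bool) :
    ∃ g₀, ∀ g ≠ g₀, HasArm φ P m c e g := by
  obtain ⟨r, hr, hs, ht⟩ := H.level3_inside c e
  have ht' := H.partner_comm ht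
  have key : ∀ g, P.Prefers (t c e 0) (p c e g 1) (m (t c e 0)) ∨
      P.Prefers (s c e 0) (q c e g 0) (m (s c e 0)) → HasArm φ P m c e g := by
    intro g h
    rcases H.level2_inside c e g with ⟨h0, h1, h2⟩ | h' | h'
    · rcases h with h | h
      · exact H.hasArm_of_t hr hs ht h h1 h2
      · exact H.hasArm_of_s hr hs ht h h0 h2
    · exact H.hasArm_of_unstable (Or.inl h')
    · exact H.hasArm_of_unstable (Or.inr h')
  rcases fin_four_cases hr with rfl | rfl | rfl
  · refine ⟨0, fun g hg => key g (Or.inl ?_)⟩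
    have : g = 1 ∨ g = 2 := by lia
    rcases this with rfl | rfl
    · exact H.inst.prefers [_, _, _] (fun _ _ _ => rfl) (by simp [ht'])
    · exact H.inst.prefers [_] (fun _ _ _ => rfl) (by simp [ht'])
  · refine ⟨1, fun g hg => key g ?_⟩
    have : g = 0 ∨ g = 2 := by lia
    rcases this with rfl | rfl
    · exact Or.inr (H.inst.prefers [_] (fun _ _ _ => rfl) (by simp [hs]))
    · exact Or.inl (H.inst.prefers [_] (fun _ _ _ => rfl) (by simp [ht']))
  · refine ⟨2, fun g hg => key g (Or.inr ?_)⟩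
    have : g = 0 ∨ g = 1 := by lia
    rcases this with rfl | rfl
    · exact H.inst.prefers [_] (fun _ _ _ => rfl) (by simp [hs])
    · exact H.inst.prefers [_, _, _] (fun _ _ _ => rfl) (by simp [hs])

/-- Two arms to the ends of the same edge cannot coexist. -/
theorem IsArm.false_of_partner (H : IsPopularIn φ P m) {c : C} {w w' f f' : GadgetVertex V C}
    {E E' : List (GadgetVertex V C × GadgetVertex V C)} (h : IsArm P m c false w f E)
    (h' : IsArm P m c true w' f' E') (hw : w ∈ topVertices) (hw' : w' ∈ topVertices)
    (hp : m w = w') : False := by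
  have hne : w ≠ w' := fun h => H.pop.ne w (by rw [hp, h])
  have hs := H.pop.sum_gain_le (E ++ E') [f, f'] (by
    rw [ends_append]
    exact h.nodup.append h'.nodup (h.disjoint h' hw hw' hne)) (by
    intro u hu
    have h1 := h.partner_mem u
    have h2 := h'.partner_mem u
    rw [hp] at h1
    rw [H.partner_comm hp] at h2
    have := h.mem
    have := h'.mem
    simp only [ends_append, List.mem_append, List.mem_cons] at hu ⊢
    grind)
  have := h.two_le
  have := h'.two_le
  simp at hs
  linarith

/-- Two arms to different level 1 gadgets are joined through `z 0` and `z 1`. -/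
theorem IsArm.false_of_ne (H : IsPopularIn φ P m) {c : C} {w w' f f' : GadgetVertex V C}
    {E E' : List (GadgetVertex V C × GadgetVertex V C)} (h : IsArm P m c false w f E)
    (h' : IsArm P m c true w' f' E') (hw : w ∈ topVertices) (hw' : w' ∈ topVertices)
    (hm : m w ∈ topVertices) (hm' : m w' ∈ topVertices) (hne : w.gadget ≠ w'.gadget) : False := by
  have key : ∀ w ∈ (topVertices : Set (GadgetVertex V C)), ∃ i, w.gadget = .level1 i := by
    rintro _ ⟨i, rfl | rfl⟩ <;> exact ⟨i, rfl⟩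
  have hg := H.gadget_partner w
  have hg' := H.gadget_partner w'
  have hz0 := H.partner_z_zero
  have hz1 := H.partner_comm hz0
  have hE : ∀ v, (∃ i, v.gadget = .level1 i) ∨ v.gadget = .Z → v ≠ w → v ∉ ends E := by
    intro v hv hvw hvE
    rcases h.gadget_eq v hvE with h | ⟨g, h⟩ | h <;> simp_all
  have hE' : ∀ v, (∃ i, v.gadget = .level1 i) ∨ v.gadget = .Z → v ≠ w' → v ∉ ends E' := by
    intro v hv hvw hvE
    rcases h'.gadget_eq v hvE with h | ⟨g, h⟩ | h <;> simp_all
  obtain ⟨i, hi⟩ := key w hw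
  obtain ⟨j, hj⟩ := key w' hw'
  rw [hi] at hg
  rw [hj] at hg'
  have hz : ∀ {v : GadgetVertex V C} {i k}, v.gadget = .level1 i → v ≠ z k := by
    rintro _ i k h rfl
    simp [gadget] at h
  have hij : i ≠ j := fun h => hne (by rw [hi, hj, h])
  have hl : ∀ {u v : GadgetVertex V C}, u.gadget = .level1 i → v.gadget = .level1 j → u ≠ v := by
    rintro u v hu hv rfl
    simp_all
  have hs := H.pop.sum_gain_le ((m w, z 0) :: (z 1, m w') :: (E ++ E')) [f, f'] (by
    have n1 := hE _ (Or.inl ⟨i, hg⟩) (H.pop.ne w)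
    have n2 := hE' _ (Or.inl ⟨i, hg⟩) (hl hg hj)
    have n3 := hE _ (Or.inl ⟨j, hg'⟩) (hl hi hg').symm
    have n4 := hE' _ (Or.inl ⟨j, hg'⟩) (H.pop.ne w')
    have n5 : ∀ k, z k ∉ ends E := fun k => hE (z k) (Or.inr rfl) (hz hi).symm
    have n6 : ∀ k, z k ∉ ends E' := fun k => hE' (z k) (Or.inr rfl) (hz hj).symm
    have n7 := h.nodup.append h'.nodup (h.disjoint h' hw hw' (hl hi hj))
    simp [n1, n2, n3, n4, n5, n6, n7, hz hg, hl hg hg', (hz hg').symm]) (by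
    intro u hu
    have h1 := h.partner_mem u
    have h2 := h'.partner_mem u
    have h3 := h.mem
    have h4 := h'.mem
    simp only [ends_cons, ends_append, List.mem_append, List.mem_cons] at hu ⊢
    rcases hu with rfl | rfl | rfl | rfl | hu | hu
    · simp [H.pop.invol, h3]
    · simp [hz0]
    · simp [hz1]
    · simp [H.pop.invol, h4]
    · have := h1 hu; tauto
    · have := h2 hu; tauto)
  have := h.two_le
  have := h'.two_le
  have := H.gain_z_zero (w := m w) (Or.inr (Or.inr (Or.inl hm)))
  have := H.gain_z_one (w := m w') (Or.inr (Or.inr (Or.inl hm')))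
  simp at hs
  linarith

/-- Some level 1 gadget of a clause is unstable. -/
theorem IsPopularIn.exists_unstable (H : IsPopularIn φ P m) (c : C) :
    ∃ r, m (x (φ.var c r)) = y' (φ.var c r) ∧ m (x' (φ.var c r)) = y (φ.var c r) := by
  by_contra hn
  have hxy : ∀ r, m (x (φ.var c r)) = y (φ.var c r) := fun r =>
    ((H.level1_inside _).resolve_right fun h => hn ⟨r, h⟩).1
  have hyx := fun r => H.partner_comm (hxy r)
  obtain ⟨g₀, h₀⟩ := H.exists_hasArm c false
  obtain ⟨g₁, h₁⟩ := H.exists_hasArm c true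
  obtain ⟨g, g', hg, hg', hgg⟩ : ∃ g g', g ≠ g₀ ∧ g' ≠ g₁ ∧ g ≠ g' := by
    clear h₀ h₁
    revert g₀ g₁
    decide
  have hv : ∀ r r', r ≠ r' → φ.var c r ≠ φ.var c r' := fun r r' h h' => h (φ.var_injective c h')
  have tx : ∀ i, (x i : GadgetVertex V C) ∈ topVertices := fun i => ⟨i, Or.inl rfl⟩
  have ty : ∀ i, (y i : GadgetVertex V C) ∈ topVertices := fun i => ⟨i, Or.inr rfl⟩
  rcases h₀ g hg with ⟨f, E, h⟩ | ⟨f, E, h⟩ <;> rcases h₁ g' hg' with ⟨f', E', h'⟩ | ⟨f', E', h'⟩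
  · exact IsArm.false_of_ne H h h' (tx _) (tx _) (hxy _ ▸ ty _) (hxy _ ▸ ty _)
      (by simpa [gadget] using hv _ _ (by simpa using hgg))
  · by_cases hr : g + 2 = g' + 1
    · exact IsArm.false_of_partner H h h' (tx _) (ty _) (by rw [hxy, hr])
    · exact IsArm.false_of_ne H h h' (tx _) (ty _) (hxy _ ▸ ty _) (hyx _ ▸ tx _)
        (by simpa [gadget] using hv _ _ hr)
  · by_cases hr : g + 1 = g' + 2
    · exact IsArm.false_of_partner H h h' (ty _) (tx _) (by rw [hyx, hr])
    · exact IsArm.false_of_ne H h h' (ty _) (tx _) (hyx _ ▸ tx _) (hxy _ ▸ ty _)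
        (by simpa [gadget] using hv _ _ hr)
  · exact IsArm.false_of_ne H h h' (ty _) (ty _) (hyx _ ▸ tx _) (hyx _ ▸ tx _)
      (by simpa [gadget] using hv _ _ (by simpa using hgg))

theorem IsPopularIn.existsUnique_unstable (H : IsPopularIn φ P m) (c : C) :
    ∃! r, m (x (φ.var c r)) = y' (φ.var c r) ∧ m (x' (φ.var c r)) = y (φ.var c r) := by
  obtain ⟨r, hr⟩ := H.exists_unstable c
  refine ⟨r, hr, fun r' hr' => ?_⟩
  by_contra hne
  have : r' = r + 1 ∨ r = r' + 1 := by lia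
  rcases this with rfl | rfl
  · refine H.not_unstable_and_unstable c (r + 2) ?_ ?_
    · rwa [show r + 2 + 1 = r by lia]
    · rwa [show r + 2 + 2 = r + 1 by lia]
  · refine H.not_unstable_and_unstable c (r' + 2) ?_ ?_
    · rwa [show r' + 2 + 1 = r' by lia]
    · rwa [show r' + 2 + 2 = r' + 1 by lia]

end Clauses

/-! ### Popular matchings and 1-in-3 satisfying assignments -/

theorem GadgetVertex.finite [Finite V] [Finite C] : Finite (GadgetVertex V C) := by
  let f : Fin 4 ⊕ Fin 6 ⊕ (Fin 4 × V) ⊕ (Bool × C × Bool × Fin 3 × Fin 2) ⊕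
      (Bool × C × Bool × Fin 3 × Fin 3) ⊕ (Bool × C × Bool × Fin 4) → GadgetVertex V C :=
    Sum.elim d <| Sum.elim z <| Sum.elim (fun k => ![x, x', y, y'] k.1 k.2) <|
      Sum.elim (fun k => (bif k.1 then a else b) k.2.1 k.2.2.1 k.2.2.2.1 k.2.2.2.2) <|
      Sum.elim (fun k => (bif k.1 then p else q) k.2.1 k.2.2.1 k.2.2.2.1 k.2.2.2.2) <|
      fun k => (bif k.1 then s else t) k.2.1 k.2.2.1 k.2.2.2
  refine Finite.of_surjective f fun u => ?_
  cases u with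
  | d i => exact ⟨.inl i, rfl⟩
  | z i => exact ⟨.inr (.inl i), rfl⟩
  | x i => exact ⟨.inr (.inr (.inl (0, i))), rfl⟩
  | x' i => exact ⟨.inr (.inr (.inl (1, i))), rfl⟩
  | y i => exact ⟨.inr (.inr (.inl (2, i))), rfl⟩
  | y' i => exact ⟨.inr (.inr (.inl (3, i))), rfl⟩
  | a c e g r => exact ⟨.inr (.inr (.inr (.inl (true, c, e, g, r)))), rfl⟩
  | b c e g r => exact ⟨.inr (.inr (.inr (.inl (false, c, e, g, r)))), rfl⟩
  | p c e g r => exact ⟨.inr (.inr (.inr (.inr (.inl (true, c, e, g, r))))), rfl⟩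
  | q c e g r => exact ⟨.inr (.inr (.inr (.inr (.inl (false, c, e, g, r))))), rfl⟩
  | s c e r => exact ⟨.inr (.inr (.inr (.inr (.inr (true, c, e, r))))), rfl⟩
  | t c e r => exact ⟨.inr (.inr (.inr (.inr (.inr (false, c, e, r))))), rfl⟩

/-- The reference matchings are perfect. -/
theorem GadgetVertex.even_card [Fintype (GadgetVertex V C)] :
    Even (Fintype.card (GadgetVertex V C)) := by
  have hν : ∀ i : Fin 4, ![1, 0, 3, 2] (![1, 0, 3, 2] i) = i := by decide
  have h := matchingOf_isMatching (W := GadgetVertex V C) _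
    (refPartner_refPartner true (fun _ _ => 1) hν)
  refine SimpleGraph.Subgraph.IsPerfectMatching.even_card ⟨h, fun u => ?_⟩
  change refPartner _ _ _ u ≠ u
  cases u with
  | d i => fin_cases i <;> simp [refPartner]
  | z i => fin_cases i <;> simp [refPartner]
  | _ => simp [refPartner]

theorem IsInstanceOf.exists_isPopularIn [Fintype (GadgetVertex V C)] {φ : MonotoneFormula V C}
    {P : Preferences (GadgetVertex V C)} (hP : IsInstanceOf φ P) {M : EdgeSet (GadgetVertex V C)}
    (hM : P.IsPopular M) : ∃ m, IsPopularIn φ P m ∧ ∀ u v, M.Adj u v ↔ m u = v := by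
  obtain ⟨m, hm, h⟩ := hM.exists_involution even_card
  exact ⟨m, ⟨hP, hm⟩, h⟩

end

theorem mainTheorem2 {V C : Type*} [Finite V] [Finite C] (φ : MonotoneFormula V C)
    (P : Preferences (GadgetVertex V C)) (hP : IsInstanceOf φ P) :
    (∀ M : EdgeSet (GadgetVertex V C), P.IsPopular M →
      (∀ u v, M.Adj u v → u.gadget = v.gadget) ∧
      (∀ c, ∃! r : Fin 3, IsUnstable P M (Gadget.level1 (φ.var c r)))) ∧
    ((∃ M : EdgeSet (GadgetVertex V C), P.IsPopular M) →
      ∃ S : V → Bool, φ.IsOneInThree S) := by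
  classical
  have := GadgetVertex.finite (V := V) (C := C)
  have := Fintype.ofFinite (GadgetVertex V C)
  have key : ∀ M : EdgeSet (GadgetVertex V C), P.IsPopular M →
      ∀ c, ∃! r : Fin 3, IsUnstable P M (Gadget.level1 (φ.var c r)) := by
    intro M hM c
    obtain ⟨m, H, hm⟩ := hP.exists_isPopularIn hM
    simpa only [H.isUnstable_iff hm] using H.existsUnique_unstable c
  refine ⟨fun M hM => ⟨fun u v huv => ?_, key M hM⟩, ?_⟩
  · obtain ⟨m, H, hm⟩ := hP.exists_isPopularIn hM
    rw [← (hm u v).1 huv, H.gadget_partner]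
  · rintro ⟨M, hM⟩
    exact ⟨fun i => decide (IsUnstable P M (.level1 i)), fun c => by simpa using key M hM c⟩
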